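/- \textbf{Conventions.} Let $\mathcal A,\mathcal B,\mathcal C$ be bicategories. For a pseudonatural transformation $\Phi$ and pseudofunctors $P,Q$, write $\Phi_P$ (components $\Phi_{P(X)}$) and $Q(\Phi)$ (components $Q(\Phi_X)$) for its whiskerings, and similarly for modifications; the unit pseudofunctor is suppressed in whiskerings ($\Phi_P\colon P\Rightarrow TP$ and $Q(\Phi)\colon Q\Rightarrow QT$ if $\Phi\colon 1\Rightarrow T$), and $\mathrm A$ denotes the associators (with identity components) of composition of pseudofunctors. A \emph{biadjunction} $L\dashv F$ consists of pseudofunctors $L,F$, pseudonatural transformations (unit) $1\Rightarrow FL$ and (counit) $LF\Rightarrow 1$ and invertible modifications filling the two triangles (no further coherence is required). An \emph{inverter} of a 2-morphism $\varphi\colon f_1\Rightarrow f_2\colon X_1\to X_2$ in a bicategory is a pair $(X_0,f_0\colon X_0\to X_1)$ such that $\varphi*f_0$ is invertible and, for every object $X$, composition with $f_0$ is an equivalence from $\mathrm{Hom}(X,X_0)$ to the full subcategory of $\mathrm{Hom}(X,X_1)$ on those $f$ with $\varphi*f$ invertible. \textbf{Data.} Let $L\dashv F$ with $F\colon\mathcal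 A\to\mathcal B$, $L\colon\mathcal B\to\mathcal A$ be a biadjunction with unit $\Phi$; let $N\dashv H$ with $H\colon\mathcal A\to\mathcal C$, $N\colon\mathcal C\to\mathcal A$ be a biadjunction with unit $\Psi$ and counit $\Upsilon$; let $G\colon\mathcal B\to\mathcal C$ be a pseudofunctor and $\Gamma\colon GF\simeq H$ a pseudonatural equivalence (taken, as one always may, to be part of an adjoint equivalence). Put \begin{align*} \Psi'&=\Gamma^{-1}_N\circ\Psi\colon 1_{\mathcal C}\Rightarrow (GF)N, & \Upsilon'&=\Upsilon\circ N(\Gamma)\colon N(GF)\Rightarrow 1_{\mathcal A},\\ \Phi'&\colon G\xRightarrow{G\Phi}G(FL)\xRightarrow{\mathrm A^{-1}}(GF)L, & \Theta&\colon NG\xRightarrow{N(\Phi')}N((GF)L)\xRightarrow{\mathrm A^{-1}}(N(GF))L\xRightarrow{\Upsilon'_L}L,\\ \Theta'&\colon (FN)G\xRightarrow{\mathrm A}F(NG)\xRightarrow{F\Theta}FL, & \Psi''&\colon 1_{\mathcal C}\xRightarrow{\Psi'}(GF)N\xRightarrow{\mathrm A}G(FN),\\ \Xi'&\colon FN\xRightarrow{FN(\Psi'')}(FN)(G(FN))\xRightarrow{\mathrm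 A^{-1}}((FN)G)(FN), & \Xi&=\Theta'_{FN}\circ\Xi'\colon FN\Rightarrow (FL)(FN), \end{align*} and $\Theta''\colon ((FL)(FN))G\xRightarrow{\mathrm A}(FL)((FN)G)\xRightarrow{FL(\Theta')}(FL)(FL)$. Let $\phi_1\colon \Theta''\circ(\Phi_{FN})_G\cong\Phi_{FL}\circ\Theta'$ be the invertible modification composed of $\mathrm A\circ(\Phi_{FN})_G\cong\Phi_{(FN)G}$ and the exchange $\Phi_{\Theta'}\colon FL(\Theta')\circ\Phi_{(FN)G}\cong\Phi_{FL}\circ\Theta'$. Let $\phi_2\colon\Theta''\circ\Xi_G\cong FL(\Phi)\circ\Theta'$ be the invertible modification obtained as follows. (a) Pasting pseudonaturality of associators, pentagonators and compositors with the exchanges of $\Gamma$ and $\Gamma^{-1}$, with the right triangle modification of $N\dashv H$ and with $\Gamma^{-1}\circ\Gamma\cong 1$, one gets the right triangle modification $(GF)(\Upsilon')\circ\mathrm A\circ\Psi'_{GF}\cong 1_{GF}$. (b) Expanding $\Psi''$, $\Theta'$, $\Theta$ and using pentagonators, pseudonaturality of associators, the exchange $\Psi'_{\Phi'}\colon ((GF)N)(\Phi')\circ\Psi'_G\cong\Psi'_{(GF)L}\circ\Phi'$,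 the modification (a) pre-whiskered by $L$, and $\mathrm A\circ\Phi'\cong G\Phi$, one gets $\phi_2''\colon G(\Theta')\circ\mathrm A\circ\Psi''_G\cong G\Phi$. (c) Associativity of whiskering, a pentagonator and $FN(\phi_2'')$ give $((FN)G)(\Theta')\circ\mathrm A\circ\Xi'_G\cong((FN)G)(\Phi)$. (d) $\phi_2$ is the composite \begin{align*} \Theta''\circ\Xi_G&\cong FL(\Theta')\circ\Theta'_{(FN)G}\circ\mathrm A\circ\Xi'_G\cong\Theta'_{FL}\circ((FN)G)(\Theta')\circ\mathrm A\circ\Xi'_G\\ &\cong\Theta'_{FL}\circ((FN)G)(\Phi)\cong FL(\Phi)\circ\Theta', \end{align*} using the exchanges $\Theta'_{\Theta'}$ and $\Theta'_\Phi$ and (c). \textbf{Theorem.} Assume: \begin{enumerate} \item there is a modification $\mu\colon\Phi_{FN}\Rrightarrow\Xi$ such that for every object $C$ of $\mathcal C$ the 2-morphism $\mu_C$ has an inverter $(M(C),\Lambda_C\colon M(C)\to FN(C))$ in $\mathcal B$; \item $G$ transforms every inverter in $\mathcal B$ into an inverter in $\mathcal C$: if $(X_0,f_0)$ is an inverter of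 $\varphi$, then $(G(X_0),G(f_0))$ is an inverter of $G(\varphi)$; \item $G(\mu)*\Psi''$ is invertible; \item there is a modification $\nu\colon\Phi_{FL}\Rrightarrow FL(\Phi)$ such that \[\phi_2\circ(\Theta''*\mu_G)=(\nu*\Theta')\circ\phi_1\] and such that $(B,\Phi_B)$ is an inverter of $\nu_B$ for every object $B$ of $\mathcal B$. \end{enumerate} Then the objects $M(C)$ and the 1-morphisms $\Lambda_C$ combine into a pseudofunctor $M\colon\mathcal C\to\mathcal B$ and a pseudonatural transformation $\Lambda\colon M\Rightarrow FN$ with these values on objects and these components, $(M,\Lambda)$ is an inverter of $\mu$ in the bicategory $\mathcal B^{\mathcal C}$ of pseudofunctors, and $M$ is left biadjoint to $G$. -/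

import Mathlib

open CategoryTheory Bicategory
open scoped Pseudofunctor.StrongTrans

universe w₁ w₂ w₃ w₄ w₅ v₁ v₂ v₃ v₄ v₅ u₁ u₂ u₃ u₄ u₅
namespace BiTri
section
variable {A : Type u₁} [Bicategory.{w₁, v₁} A] {B : Type u₂} [Bicategory.{w₂, v₂} B]
  {C : Type u₃} [Bicategory.{w₃, v₃} C] {D : Type u₄} [Bicategory.{w₄, v₄} D]
  {E : Type u₅} [Bicategory.{w₅, v₅} E]

theorem map₂_rightUnitor_inv (G : A ⥤ᵖ B) {a b : A} (f : a ⟶ b) :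
    G.map₂ (ρ_ f).inv =
      (ρ_ (G.map f)).inv ≫ G.map f ◁ (G.mapId b).inv ≫ (G.mapComp f (𝟙 b)).inv := by
  rw [← cancel_epi (G.map₂ (ρ_ f).hom), ← G.map₂_comp]; simp

theorem map₂_leftUnitor_inv (G : A ⥤ᵖ B) {a b : A} (f : a ⟶ b) :
    G.map₂ (λ_ f).inv =
      (λ_ (G.map f)).inv ≫ (G.mapId a).inv ▷ G.map f ≫ (G.mapComp (𝟙 a) f).inv := by
  rw [← cancel_epi (G.map₂ (λ_ f).hom), ← G.map₂_comp]; simp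

theorem map₂_associator_inv (G : A ⥤ᵖ B) {a b c d : A} (f : a ⟶ b) (g : b ⟶ c) (h : c ⟶ d) :
    G.map₂ (α_ f g h).inv =
      (G.mapComp f (g ≫ h)).hom ≫ G.map f ◁ (G.mapComp g h).hom ≫ (α_ _ _ _).inv ≫
        (G.mapComp f g).inv ▷ G.map h ≫ (G.mapComp (f ≫ g) h).inv := by
  rw [← cancel_epi (G.map₂ (α_ f g h).hom), ← G.map₂_comp]; simp

theorem map₂_comp_comp (G : A ⥤ᵖ B) {a b : A} {f g h : a ⟶ b} (p : f ⟶ g) (q : g ⟶ h)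
    {k : G.obj a ⟶ G.obj b} (r : G.map h ⟶ k) :
    G.map₂ (p ≫ q) ≫ r = G.map₂ p ≫ G.map₂ q ≫ r := by simp

/-! ### Squares filled with an invertible 2-morphism -/

/-- The image under a pseudofunctor of a square filled with an invertible 2-morphism. -/
def mapSq (G : A ⥤ᵖ B) {X Y X' Y' : A} {f : X ⟶ Y} {b : Y ⟶ Y'} {a : X ⟶ X'} {g : X' ⟶ Y'}
    (s : f ≫ b ≅ a ≫ g) : G.map f ≫ G.map b ≅ G.map a ≫ G.map g :=
  (G.mapComp f b).symm ≪≫ G.map₂Iso s ≪≫ G.mapComp a g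

/-- The square between identities filled with the unitors. -/
def idSq {X Y : A} (f : X ⟶ Y) : f ≫ 𝟙 Y ≅ 𝟙 X ≫ f := ρ_ f ≪≫ (λ_ f).symm

/-- The pasting of two squares filled with invertible 2-morphisms. -/
def compSq {X Y X' Y' X'' Y'' : A} {f : X ⟶ Y} {b : Y ⟶ Y'} {a : X ⟶ X'} {g : X' ⟶ Y'}
    {b' : Y' ⟶ Y''} {a' : X' ⟶ X''} {h : X'' ⟶ Y''} (s : f ≫ b ≅ a ≫ g) (t : g ≫ b' ≅ a' ≫ h) :
    f ≫ b ≫ b' ≅ (a ≫ a') ≫ h where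
  hom := (α_ f b b').inv ≫ s.hom ▷ b' ≫ (α_ a g b').hom ≫ a ◁ t.hom ≫ (α_ a a' h).inv
  inv := (α_ a a' h).hom ≫ a ◁ t.inv ≫ (α_ a g b').inv ≫ s.inv ▷ b' ≫ (α_ f b b').hom

theorem mapSq_naturality (G : A ⥤ᵖ B) {X Y X' Y' : A} {f f' : X ⟶ Y} {b : Y ⟶ Y'} {a : X ⟶ X'}
    {g g' : X' ⟶ Y'} {s : f ≫ b ≅ a ≫ g} {s' : f' ≫ b ≅ a ≫ g'} {η : f ⟶ f'} {θ : g ⟶ g'}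
    (h : η ▷ b ≫ s'.hom = s.hom ≫ a ◁ θ) :
    G.map₂ η ▷ G.map b ≫ (mapSq G s').hom = (mapSq G s).hom ≫ G.map a ◁ G.map₂ θ := by
  have := congrArg G.map₂ h
  simp only [PrelaxFunctor.map₂_comp, Pseudofunctor.map₂_whisker_left,
    Pseudofunctor.map₂_whisker_right, Category.assoc] at this
  rw [← cancel_epi (G.mapComp f b).hom, ← cancel_mono (G.mapComp a g').inv]
  simpa [mapSq] using this

theorem mapSq_id (G : A ⥤ᵖ B) {X Y : A} {f : X ⟶ X} {p : X ⟶ Y} {g : Y ⟶ Y} {s : f ≫ p ≅ p ≫ g}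
    {x : f ≅ 𝟙 X} {y : g ≅ 𝟙 Y}
    (h : s.hom ≫ p ◁ y.hom = x.hom ▷ p ≫ (λ_ p).hom ≫ (ρ_ p).inv)
    (x' : G.map f ≅ 𝟙 (G.obj X)) (hx : x'.hom = G.map₂ x.hom ≫ (G.mapId X).hom)
    (y' : G.map g ≅ 𝟙 (G.obj Y)) (hy : y'.hom = G.map₂ y.hom ≫ (G.mapId Y).hom) :
    (mapSq G s).hom ≫ G.map p ◁ y'.hom =
      x'.hom ▷ G.map p ≫ (λ_ (G.map p)).hom ≫ (ρ_ (G.map p)).inv := by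
  have := congrArg G.map₂ h
  simp only [PrelaxFunctor.map₂_comp, Pseudofunctor.map₂_whisker_left,
    Pseudofunctor.map₂_whisker_right, Category.assoc] at this
  rw [hx, hy, ← cancel_epi (G.mapComp f p).hom]
  have h2 := this =≫ ((G.mapComp p (𝟙 Y)).hom ≫ G.map p ◁ (G.mapId Y).hom)
  simpa [mapSq, map₂_rightUnitor_inv] using h2

theorem mapSq_comp (G : A ⥤ᵖ B) {X Y Z X' Y' Z' : A} {k : X ⟶ Z} {f : X ⟶ Y} {g : Y ⟶ Z}
    {k' : X' ⟶ Z'} {f' : X' ⟶ Y'} {g' : Y' ⟶ Z'} {a : X ⟶ X'} {b : Y ⟶ Y'} {c : Z ⟶ Z'}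
    {r : k ≫ c ≅ a ≫ k'} {s : f ≫ b ≅ a ≫ f'} {t : g ≫ c ≅ b ≫ g'}
    {x : k ≅ f ≫ g} {y : k' ≅ f' ≫ g'}
    (h : r.hom ≫ a ◁ y.hom = x.hom ▷ c ≫ (α_ _ _ _).hom ≫ f ◁ t.hom ≫
      (α_ _ _ _).inv ≫ s.hom ▷ g' ≫ (α_ _ _ _).hom)
    (x' : G.map k ≅ G.map f ≫ G.map g) (hx : x'.hom = G.map₂ x.hom ≫ (G.mapComp f g).hom)
    (y' : G.map k' ≅ G.map f' ≫ G.map g') (hy : y'.hom = G.map₂ y.hom ≫ (G.mapComp f' g').hom) :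
    (mapSq G r).hom ≫ G.map a ◁ y'.hom =
      x'.hom ▷ G.map c ≫ (α_ _ _ _).hom ≫ G.map f ◁ (mapSq G t).hom ≫
        (α_ _ _ _).inv ≫ (mapSq G s).hom ▷ G.map g' ≫ (α_ _ _ _).hom := by
  have := congrArg G.map₂ h
  simp only [PrelaxFunctor.map₂_comp, Pseudofunctor.map₂_whisker_left,
    Pseudofunctor.map₂_whisker_right, Category.assoc] at this
  rw [hx, hy, ← cancel_epi (G.mapComp k c).hom]
  have h2 := this =≫ ((G.mapComp a (f' ≫ g')).hom ≫ G.map a ◁ (G.mapComp f' g').hom)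
  simpa [mapSq, map₂_associator_inv] using h2

theorem idSq_naturality {X Y : A} {f g : X ⟶ Y} (η : f ⟶ g) :
    η ▷ 𝟙 Y ≫ (idSq g).hom = (idSq f).hom ≫ 𝟙 X ◁ η := by
  simp [idSq]

theorem idSq_id {X : A} {f : X ⟶ X} (x y : f ≅ 𝟙 X) (h : x.hom = y.hom) :
    (idSq f).hom ≫ 𝟙 X ◁ x.hom = y.hom ▷ 𝟙 X ≫ (λ_ (𝟙 X)).hom ≫ (ρ_ (𝟙 X)).inv := by
  simp [idSq, h, unitors_equal, unitors_inv_equal]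

theorem idSq_comp {X Y Z : A} {f : X ⟶ Y} {g : Y ⟶ Z} {k : X ⟶ Z} (x y : k ≅ f ≫ g)
    (h : x.hom = y.hom) :
    (idSq k).hom ≫ 𝟙 X ◁ x.hom =
      y.hom ▷ 𝟙 Z ≫ (α_ _ _ _).hom ≫ f ◁ (idSq g).hom ≫ (α_ _ _ _).inv ≫
        (idSq f).hom ▷ g ≫ (α_ _ _ _).hom := by
  simp [idSq, h]

section sqLemmas

variable {X Y X' Y' X'' Y'' : A} {f : X ⟶ Y} {b : Y ⟶ Y'} {a : X ⟶ X'} {g : X' ⟶ Y'}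
    {b' : Y' ⟶ Y''} {a' : X' ⟶ X''} {h : X'' ⟶ Y''}

theorem nat_refl (s : f ≫ b ≅ a ≫ g) : f ◁ (Iso.refl b).hom ≫ s.hom = s.hom ≫ (Iso.refl a).hom ▷ g := by
  simp

theorem nat_mapMod (G : A ⥤ᵖ B) {b₂ : Y ⟶ Y'} {a₂ : X ⟶ X'} {s : f ≫ b ≅ a ≫ g} {t : f ≫ b₂ ≅ a₂ ≫ g}
    {β : b ⟶ b₂} {α : a ⟶ a₂} (e : f ◁ β ≫ t.hom = s.hom ≫ α ▷ g) :
    G.map f ◁ G.map₂ β ≫ (mapSq G t).hom = (mapSq G s).hom ≫ G.map₂ α ▷ G.map g := by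
  have := congrArg G.map₂ e
  simp only [PrelaxFunctor.map₂_comp, Pseudofunctor.map₂_whisker_left,
    Pseudofunctor.map₂_whisker_right, Category.assoc] at this
  rw [← cancel_epi (G.mapComp f b).hom, ← cancel_mono (G.mapComp a₂ g).inv]
  simpa [mapSq] using this

theorem nat_mapComp (G : A ⥤ᵖ B) (s : f ≫ b ≅ a ≫ g) (t : g ≫ b' ≅ a' ≫ h) :
    G.map f ◁ (G.mapComp b b').hom ≫ (compSq (mapSq G s) (mapSq G t)).hom =
      (mapSq G (compSq s t)).hom ≫ (G.mapComp a a').hom ▷ G.map h := by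
  simp [mapSq, compSq, map₂_associator_inv]

theorem nat_mapId (G : A ⥤ᵖ B) (f : X ⟶ Y) :
    G.map f ◁ (G.mapId Y).hom ≫ (idSq (G.map f)).hom =
      (mapSq G (idSq f)).hom ≫ (G.mapId X).hom ▷ G.map f := by
  have e : (mapSq G (idSq f)).hom =
      (G.mapComp f (𝟙 Y)).inv ≫ G.map₂ ((ρ_ f).hom ≫ (λ_ f).inv) ≫ (G.mapComp (𝟙 X) f).hom := rfl
  rw [e]
  simp [idSq, map₂_leftUnitor_inv]

theorem nat_left (s t : f ≫ b ≅ a ≫ g) (e : s.hom = t.hom) :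
    f ◁ (λ_ b).hom ≫ t.hom = (compSq (idSq f) s).hom ≫ (λ_ a).hom ▷ g := by
  simp [compSq, idSq, e]

theorem nat_right (s t : f ≫ b ≅ a ≫ g) (e : s.hom = t.hom) :
    f ◁ (ρ_ b).hom ≫ t.hom = (compSq s (idSq g)).hom ≫ (ρ_ a).hom ▷ g := by
  simp [compSq, idSq, e]

theorem nat_swap (s t : f ≫ b ≅ a ≫ g) (e : s.hom = t.hom) :
    f ◁ (ρ_ b ≪≫ (λ_ b).symm).hom ≫ (compSq (idSq f) t).hom =
      (compSq s (idSq g)).hom ≫ (ρ_ a ≪≫ (λ_ a).symm).hom ▷ g := by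
  simp [compSq, idSq, e]

theorem nat_exchange {G₁ G₂ : A ⥤ᵖ B} (Ψ : G₁ ⟶ G₂) (s : f ≫ b ≅ a ≫ g)
    (u : G₁.map f ≫ G₁.map b ≅ G₁.map a ≫ G₁.map g) (hu : u.hom = (mapSq G₁ s).hom)
    (v : G₂.map f ≫ G₂.map b ≅ G₂.map a ≫ G₂.map g) (hv : v.hom = (mapSq G₂ s).hom) :
    G₁.map f ◁ (Ψ.naturality b).symm.hom ≫ (compSq u (Ψ.naturality g)).hom =
      (compSq (Ψ.naturality f) v).hom ≫ (Ψ.naturality a).symm.hom ▷ G₂.map g := by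
  have h₁ := Ψ.naturality_naturality s.hom
  rw [Pseudofunctor.StrongTrans.naturality_comp_hom,
    Pseudofunctor.StrongTrans.naturality_comp_hom] at h₁
  rw [← cancel_epi ((α_ _ _ _).hom ≫ G₁.map f ◁ (Ψ.naturality b).hom),
    ← cancel_mono ((Ψ.naturality a).hom ▷ G₂.map g ≫ (α_ _ _ _).hom ≫
      Ψ.app X ◁ (G₂.mapComp a g).inv), ← cancel_epi ((G₁.mapComp f b).hom ▷ Ψ.app Y')]
  simp only [Category.assoc] at h₁
  simpa [compSq, hu, hv, mapSq] using h₁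

theorem nat_trans {b₂ b₃ : Y ⟶ Y'} {a₂ a₃ : X ⟶ X'} {s : f ≫ b ≅ a ≫ g} {t : f ≫ b₂ ≅ a₂ ≫ g}
    {r : f ≫ b₃ ≅ a₃ ≫ g} {β : b ≅ b₂} {α : a ≅ a₂} {β' : b₂ ≅ b₃} {α' : a₂ ≅ a₃}
    (h₁ : f ◁ β.hom ≫ t.hom = s.hom ≫ α.hom ▷ g)
    (h₂ : f ◁ β'.hom ≫ r.hom = t.hom ≫ α'.hom ▷ g) :
    f ◁ (β ≪≫ β').hom ≫ r.hom = s.hom ≫ (α ≪≫ α').hom ▷ g := by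
  simp [h₂, reassoc_of% h₁]

theorem nat_symm {b₂ : Y ⟶ Y'} {a₂ : X ⟶ X'} {s : f ≫ b ≅ a ≫ g} {t : f ≫ b₂ ≅ a₂ ≫ g}
    {β : b ≅ b₂} {α : a ≅ a₂} (h : f ◁ β.hom ≫ t.hom = s.hom ≫ α.hom ▷ g) :
    f ◁ β.symm.hom ≫ s.hom = t.hom ≫ α.symm.hom ▷ g := by
  rw [← cancel_epi (f ◁ β.hom), ← cancel_mono (α.hom ▷ g)]
  simp [h]

theorem mapSq_idFunctor (s : f ≫ b ≅ a ≫ g) :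
    s.hom = (mapSq (Pseudofunctor.id A) s).hom :=
  ((Category.id_comp (s.hom ≫ 𝟙 _)).trans (Category.comp_id s.hom)).symm

theorem mapSq_comp_functor (G : A ⥤ᵖ B) (H : B ⥤ᵖ C) (s : f ≫ b ≅ a ≫ g) :
    (mapSq (G.comp H) s).hom = (mapSq H (mapSq G s)).hom := by
  have e : ((H.mapComp (G.map f) (G.map b)).inv ≫ H.map₂ (G.mapComp f b).inv) ≫
      H.map₂ (G.map₂ s.hom) ≫ H.map₂ (G.mapComp a g).hom ≫ (H.mapComp (G.map a) (G.map g)).hom =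
    (H.mapComp (G.map f) (G.map b)).inv ≫ H.map₂ ((G.mapComp f b).inv ≫ G.map₂ s.hom ≫
      (G.mapComp a g).hom) ≫ (H.mapComp (G.map a) (G.map g)).hom := by simp
  exact e

end sqLemmas
/-! ### Whiskering -/

/-- Pre-whiskering `Ψ_F` of a pseudonatural transformation: components `Ψ_{F X}`. -/
def preWh (F : A ⥤ᵖ B) {G₁ G₂ : B ⥤ᵖ C} (Ψ : G₁ ⟶ G₂) : F.comp G₁ ⟶ F.comp G₂ where
  app X := Ψ.app (F.obj X)
  naturality f := Ψ.naturality (F.map f)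
  naturality_naturality η := Ψ.naturality_naturality (F.map₂ η)
  naturality_id a := by
    have h := Ψ.naturality_naturality (F.mapId a).hom
    delta Pseudofunctor.comp PrelaxFunctor.comp PrelaxFunctorStruct.comp Prefunctor.comp
    dsimp only
    simp [← reassoc_of% h]
  naturality_comp f g := by
    have h := Ψ.naturality_naturality (F.mapComp f g).hom
    delta Pseudofunctor.comp PrelaxFunctor.comp PrelaxFunctorStruct.comp Prefunctor.comp
    dsimp only
    simp [← reassoc_of% h]

/-- Post-whiskering `G(Φ)` of a pseudonatural transformation: components `G(Φ_X)`. -/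
def postWh {F₁ F₂ : A ⥤ᵖ B} (Φ : F₁ ⟶ F₂) (G : B ⥤ᵖ C) : F₁.comp G ⟶ F₂.comp G where
  app X := G.map (Φ.app X)
  naturality f := mapSq G (Φ.naturality f)
  naturality_naturality η := mapSq_naturality G (Φ.naturality_naturality η)
  naturality_id a := mapSq_id G (Φ.naturality_id a) _ rfl _ rfl
  naturality_comp f g := mapSq_comp G (Φ.naturality_comp f g) _ rfl _ rfl

/-- Pre-whiskering `Φ_F : F ⟹ T F` of `Φ : 1 ⟹ T`, where `1 F` is identified with `F`. -/
def preWhUnit (F : A ⥤ᵖ B) {T : B ⥤ᵖ B} (Φ : Pseudofunctor.id B ⟶ T) : F ⟶ F.comp T where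
  app X := Φ.app (F.obj X)
  naturality f := Φ.naturality (F.map f)
  naturality_naturality η := Φ.naturality_naturality (F.map₂ η)
  naturality_id a := by
    have h₁ := Φ.naturality_naturality (F.mapId a).hom
    have h₂ := Φ.naturality_id (F.obj a)
    revert h₁ h₂
    delta Pseudofunctor.comp PrelaxFunctor.comp PrelaxFunctorStruct.comp Prefunctor.comp
      Pseudofunctor.id PrelaxFunctor.id PrelaxFunctorStruct.id Prefunctor.id
    dsimp only
    intro h₁ h₂
    simp [← reassoc_of% h₁, h₂]
  naturality_comp f g := by
    have h₁ := Φ.naturality_naturality (F.mapComp f g).hom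
    have h₂ := Φ.naturality_comp (F.map f) (F.map g)
    revert h₁ h₂
    delta Pseudofunctor.comp PrelaxFunctor.comp PrelaxFunctorStruct.comp Prefunctor.comp
      Pseudofunctor.id PrelaxFunctor.id PrelaxFunctorStruct.id Prefunctor.id
    dsimp only
    intro h₁ h₂
    simp [← reassoc_of% h₁, h₂]

/-- Pre-whiskering `κ_F : S F ⟹ F` of `κ : S ⟹ 1`, where `1 F` is identified with `F`. -/
def preWhCounit (F : A ⥤ᵖ B) {S : B ⥤ᵖ B} (κ : S ⟶ Pseudofunctor.id B) : F.comp S ⟶ F where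
  app X := κ.app (F.obj X)
  naturality f := κ.naturality (F.map f)
  naturality_naturality η := κ.naturality_naturality (F.map₂ η)
  naturality_id a := by
    have h₁ := κ.naturality_naturality (F.mapId a).hom
    have h₂ := κ.naturality_id (F.obj a)
    revert h₁ h₂
    delta Pseudofunctor.comp PrelaxFunctor.comp PrelaxFunctorStruct.comp Prefunctor.comp
      Pseudofunctor.id PrelaxFunctor.id PrelaxFunctorStruct.id Prefunctor.id
    dsimp only
    intro h₁ h₂
    simp [← h₁] at h₂ ⊢
    simp [h₂]
  naturality_comp f g := by
    have h₁ := κ.naturality_naturality (F.mapComp f g).hom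
    have h₂ := κ.naturality_comp (F.map f) (F.map g)
    revert h₁ h₂
    delta Pseudofunctor.comp PrelaxFunctor.comp PrelaxFunctorStruct.comp Prefunctor.comp
      Pseudofunctor.id PrelaxFunctor.id PrelaxFunctorStruct.id Prefunctor.id
    dsimp only
    intro h₁ h₂
    simp [← h₁] at h₂ ⊢
    simp [h₂]

/-- Post-whiskering `G(Φ) : G ⟹ G T` of `Φ : 1 ⟹ T`, where `G 1` is identified with `G`. -/
def postWhUnit {T : A ⥤ᵖ A} (Φ : Pseudofunctor.id A ⟶ T) (G : A ⥤ᵖ B) : G ⟶ T.comp G where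
  app X := G.map (Φ.app X)
  naturality f := mapSq G (Φ.naturality f)
  naturality_naturality η := mapSq_naturality G (Φ.naturality_naturality η)
  naturality_id a := mapSq_id G (Φ.naturality_id a) (G.mapId a)
    ((Category.id_comp (G.mapId a).hom).symm.trans (congrArg (· ≫ (G.mapId a).hom) (G.map₂_id _).symm)) _ rfl
  naturality_comp f g := mapSq_comp G (Φ.naturality_comp f g) (G.mapComp f g)
    ((Category.id_comp (G.mapComp f g).hom).symm.trans (congrArg (· ≫ (G.mapComp f g).hom) (G.map₂_id _).symm)) _ rfl

/-- Post-whiskering `G(κ) : G S ⟹ G` of `κ : S ⟹ 1`, where `G 1` is identified with `G`. -/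
def postWhCounit {S : A ⥤ᵖ A} (κ : S ⟶ Pseudofunctor.id A) (G : A ⥤ᵖ B) : S.comp G ⟶ G where
  app X := G.map (κ.app X)
  naturality f := mapSq G (κ.naturality f)
  naturality_naturality η := mapSq_naturality G (κ.naturality_naturality η)
  naturality_id a := mapSq_id G (κ.naturality_id a) _ rfl (G.mapId a)
    ((Category.id_comp (G.mapId a).hom).symm.trans (congrArg (· ≫ (G.mapId a).hom) (G.map₂_id _).symm))
  naturality_comp f g := mapSq_comp G (κ.naturality_comp f g) _ rfl (G.mapComp f g)
    ((Category.id_comp (G.mapComp f g).hom).symm.trans (congrArg (· ≫ (G.mapComp f g).hom) (G.map₂_id _).symm))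

/-- The associator for the composition of pseudofunctors, with identity components.
Recall that `F.comp G` is the composite usually written `G F`. -/
def assoc (F : A ⥤ᵖ B) (G : B ⥤ᵖ C) (H : C ⥤ᵖ D) :
    F.comp (G.comp H) ⟶ (F.comp G).comp H where
  app X := 𝟙 (H.obj (G.obj (F.obj X)))
  naturality f := idSq (H.map (G.map (F.map f)))
  naturality_naturality η := idSq_naturality (H.map₂ (G.map₂ (F.map₂ η)))
  naturality_id a := idSq_id (((F.comp G).comp H).mapId a) ((F.comp (G.comp H)).mapId a)
    (map₂_comp_comp H _ _ _)
  naturality_comp f g :=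
    idSq_comp (((F.comp G).comp H).mapComp f g) ((F.comp (G.comp H)).mapComp f g)
    (map₂_comp_comp H _ _ _)

/-- The associator in the other direction, with identity components. -/
def assocInv (F : A ⥤ᵖ B) (G : B ⥤ᵖ C) (H : C ⥤ᵖ D) :
    (F.comp G).comp H ⟶ F.comp (G.comp H) where
  app X := 𝟙 (H.obj (G.obj (F.obj X)))
  naturality f := idSq (H.map (G.map (F.map f)))
  naturality_naturality η := idSq_naturality (H.map₂ (G.map₂ (F.map₂ η)))
  naturality_id a := idSq_id ((F.comp (G.comp H)).mapId a) (((F.comp G).comp H).mapId a)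
    (map₂_comp_comp H _ _ _).symm
  naturality_comp f g :=
    idSq_comp ((F.comp (G.comp H)).mapComp f g) (((F.comp G).comp H).mapComp f g)
    (map₂_comp_comp H _ _ _).symm

/-! ### Whiskering of modifications -/

/-- Pre-whiskering of a modification by a pseudofunctor. -/
def preWhMod (F : A ⥤ᵖ B) {G₁ G₂ : B ⥤ᵖ C} {Ψ Ψ' : G₁ ⟶ G₂} (μ : Ψ ⟶ Ψ') :
    preWh F Ψ ⟶ preWh F Ψ' where
  as := { app := fun X => μ.as.app (F.obj X)
          naturality := fun f => μ.as.naturality (F.map f) }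

/-- Post-whiskering of a modification by a pseudofunctor. -/
def postWhMod {F₁ F₂ : A ⥤ᵖ B} {Φ Φ' : F₁ ⟶ F₂} (μ : Φ ⟶ Φ') (G : B ⥤ᵖ C) :
    postWh Φ G ⟶ postWh Φ' G where
  as := { app := fun X => G.map₂ (μ.as.app X)
          naturality := fun f => nat_mapMod G (μ.as.naturality f) }

/-- Pre-whiskering of an invertible modification. -/
def preWhIso (F : A ⥤ᵖ B) {G₁ G₂ : B ⥤ᵖ C} {Ψ Ψ' : G₁ ⟶ G₂} (e : Ψ ≅ Ψ') :
    preWh F Ψ ≅ preWh F Ψ' where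
  hom := preWhMod F e.hom
  inv := preWhMod F e.inv
  hom_inv_id := by ext X; exact congrArg (fun m => m.as.app (F.obj X)) e.hom_inv_id
  inv_hom_id := by ext X; exact congrArg (fun m => m.as.app (F.obj X)) e.inv_hom_id

/-- Post-whiskering of an invertible modification. -/
def postWhIso {F₁ F₂ : A ⥤ᵖ B} {Φ Φ' : F₁ ⟶ F₂} (e : Φ ≅ Φ') (G : B ⥤ᵖ C) :
    postWh Φ G ≅ postWh Φ' G where
  hom := postWhMod e.hom G
  inv := postWhMod e.inv G
  hom_inv_id := by
    ext X
    have h := congrArg (fun m => m.as.app X) e.hom_inv_id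
    exact (G.map₂_comp _ _).symm.trans ((congrArg G.map₂ h).trans (G.map₂_id _))
  inv_hom_id := by
    ext X
    have h := congrArg (fun m => m.as.app X) e.inv_hom_id
    exact (G.map₂_comp _ _).symm.trans ((congrArg G.map₂ h).trans (G.map₂_id _))

/-! ### Invertible modifications relating whiskerings and associators -/

open Pseudofunctor.StrongTrans (isoMk)

/-- Pre-whiskering preserves composition. -/
def preWhComp (F : A ⥤ᵖ B) {G₁ G₂ G₃ : B ⥤ᵖ C} (Ψ : G₁ ⟶ G₂) (Ψ' : G₂ ⟶ G₃) :
    preWh F (Ψ ≫ Ψ') ≅ preWh F Ψ ≫ preWh F Ψ' :=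
  isoMk (fun _ => Iso.refl _) (fun f => nat_refl ((preWh F (Ψ ≫ Ψ')).naturality f))

/-- Pre-whiskering preserves identities. -/
def preWhId (F : A ⥤ᵖ B) (G : B ⥤ᵖ C) : preWh F (𝟙 G) ≅ 𝟙 (F.comp G) :=
  isoMk (fun _ => Iso.refl _) (fun f => nat_refl ((preWh F (𝟙 G)).naturality f))

/-- Post-whiskering preserves composition up to the compositors of `G`. -/
def postWhComp {F₁ F₂ F₃ : A ⥤ᵖ B} (Φ : F₁ ⟶ F₂) (Φ' : F₂ ⟶ F₃) (G : B ⥤ᵖ C) :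
    postWh (Φ ≫ Φ') G ≅ postWh Φ G ≫ postWh Φ' G :=
  isoMk (fun X => G.mapComp (Φ.app X) (Φ'.app X))
    (fun f => nat_mapComp G (Φ.naturality f) (Φ'.naturality f))



/-- Pre-whiskering preserves composition, when the first transformation starts from `1`. -/
def preWhUnitComp (F : A ⥤ᵖ B) {T T' : B ⥤ᵖ B} (Φ : Pseudofunctor.id B ⟶ T) (Ψ : T ⟶ T') :
    preWhUnit F (Φ ≫ Ψ) ≅ preWhUnit F Φ ≫ preWh F Ψ :=
  isoMk (fun _ => Iso.refl _) (fun f => nat_refl ((preWhUnit F (Φ ≫ Ψ)).naturality f))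

/-- Post-whiskering preserves composition, when the second transformation ends at `1`. -/
def postWhCounitComp {S S' : A ⥤ᵖ A} (Ψ : S' ⟶ S) (κ : S ⟶ Pseudofunctor.id A) (G : A ⥤ᵖ B) :
    postWhCounit (Ψ ≫ κ) G ≅ postWh Ψ G ≫ postWhCounit κ G :=
  isoMk (fun X => G.mapComp (Ψ.app X) (κ.app X))
    (fun f => nat_mapComp G (Ψ.naturality f) (κ.naturality f))

/-- The exchange of the two orders of whiskering, with components the pseudonaturality
2-morphisms of `Ψ` at the components of `Φ`. -/
def exchange {F₁ F₂ : A ⥤ᵖ B} {G₁ G₂ : B ⥤ᵖ C} (Φ : F₁ ⟶ F₂) (Ψ : G₁ ⟶ G₂) :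
    preWh F₁ Ψ ≫ postWh Φ G₂ ≅ postWh Φ G₁ ≫ preWh F₂ Ψ :=
  isoMk (fun X => (Ψ.naturality (Φ.app X)).symm)
    (fun f => nat_exchange Ψ (Φ.naturality f) (mapSq G₁ (Φ.naturality f)) rfl
      (mapSq G₂ (Φ.naturality f)) rfl)

/-- The exchange modification when the outer transformation `u` starts from `1`. -/
def unitExchange {F₁ F₂ : A ⥤ᵖ B} {T : B ⥤ᵖ B} (Φ : F₁ ⟶ F₂) (u : Pseudofunctor.id B ⟶ T) :
    preWhUnit F₁ u ≫ postWh Φ T ≅ Φ ≫ preWhUnit F₂ u :=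
  isoMk (fun X => (u.naturality (Φ.app X)).symm)
    (fun f => nat_exchange u (Φ.naturality f) (Φ.naturality f) (mapSq_idFunctor (Φ.naturality f))
      (mapSq T (Φ.naturality f)) rfl)

/-- The exchange modification when the inner transformation `u` starts from `1`. -/
def postUnitExchange {T : A ⥤ᵖ A} (u : Pseudofunctor.id A ⟶ T) {G₁ G₂ : A ⥤ᵖ B} (Ψ : G₁ ⟶ G₂) :
    postWhUnit u G₁ ≫ preWh T Ψ ≅ Ψ ≫ postWhUnit u G₂ :=
  (isoMk (η := Ψ ≫ postWhUnit u G₂) (θ := postWhUnit u G₁ ≫ preWh T Ψ)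
    (fun X => (Ψ.naturality (u.app X)).symm)
    (fun f => nat_exchange Ψ (u.naturality f) (mapSq G₁ (u.naturality f)) rfl
      (mapSq G₂ (u.naturality f)) rfl)).symm

/-- The exchange modification when the inner transformation `κ` ends at `1`. -/
def counitExchange {S : A ⥤ᵖ A} (κ : S ⟶ Pseudofunctor.id A) {G₁ G₂ : A ⥤ᵖ B} (Ψ : G₁ ⟶ G₂) :
    preWh S Ψ ≫ postWhCounit κ G₂ ≅ postWhCounit κ G₁ ≫ Ψ :=
  isoMk (fun X => (Ψ.naturality (κ.app X)).symm)
    (fun f => nat_exchange Ψ (κ.naturality f) (mapSq G₁ (κ.naturality f)) rfl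
      (mapSq G₂ (κ.naturality f)) rfl)

/-- Pseudonaturality of the associators in the outermost pseudofunctor. -/
def assocOuter (F : A ⥤ᵖ B) (G : B ⥤ᵖ C) {H₁ H₂ : C ⥤ᵖ D} (Ψ : H₁ ⟶ H₂) :
    preWh F (preWh G Ψ) ≫ assoc F G H₂ ≅ assoc F G H₁ ≫ preWh (F.comp G) Ψ :=
  isoMk (fun X => ρ_ (Ψ.app (G.obj (F.obj X))) ≪≫ (λ_ (Ψ.app (G.obj (F.obj X)))).symm)
    (fun f => nat_swap (Ψ.naturality (G.map (F.map f))) _ rfl)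

/-- Pseudonaturality of the associators in the innermost pseudofunctor. -/
def assocInner {F₁ F₂ : A ⥤ᵖ B} (Φ : F₁ ⟶ F₂) (G : B ⥤ᵖ C) (H : C ⥤ᵖ D) :
    assoc F₁ G H ≫ postWh (postWh Φ G) H ≅ postWh Φ (G.comp H) ≫ assoc F₂ G H :=
  (isoMk (η := postWh Φ (G.comp H) ≫ assoc F₂ G H) (θ := assoc F₁ G H ≫ postWh (postWh Φ G) H)
    (fun X => ρ_ (H.map (G.map (Φ.app X))) ≪≫ (λ_ (H.map (G.map (Φ.app X)))).symm)
    (fun f => nat_swap (mapSq (G.comp H) (Φ.naturality f)) (mapSq H (mapSq G (Φ.naturality f)))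
      (mapSq_comp_functor G H (Φ.naturality f)))).symm

/-- Pseudonaturality of the inverse associators in the innermost pseudofunctor. -/
def assocInvInner {F₁ F₂ : A ⥤ᵖ B} (Φ : F₁ ⟶ F₂) (G : B ⥤ᵖ C) (H : C ⥤ᵖ D) :
    assocInv F₁ G H ≫ postWh Φ (G.comp H) ≅ postWh (postWh Φ G) H ≫ assocInv F₂ G H :=
  (isoMk (η := postWh (postWh Φ G) H ≫ assocInv F₂ G H)
    (θ := assocInv F₁ G H ≫ postWh Φ (G.comp H))
    (fun X => ρ_ (H.map (G.map (Φ.app X))) ≪≫ (λ_ (H.map (G.map (Φ.app X)))).symm)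
    (fun f => nat_swap (mapSq H (mapSq G (Φ.naturality f))) (mapSq (G.comp H) (Φ.naturality f))
      (mapSq_comp_functor G H (Φ.naturality f)).symm)).symm

/-- Pseudonaturality of the associators in the outermost variable, along `u : 1 ⟹ T`. -/
def assocUnit (F : A ⥤ᵖ B) (G : B ⥤ᵖ C) {T : C ⥤ᵖ C} (u : Pseudofunctor.id C ⟶ T) :
    preWh F (preWhUnit G u) ≫ assoc F G T ≅ preWhUnit (F.comp G) u :=
  isoMk (fun X => ρ_ (u.app (G.obj (F.obj X))))
    (fun f => nat_right (u.naturality (G.map (F.map f))) _ rfl)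

/-- Pseudonaturality of the inverse associators in the outermost variable, along `u : 1 ⟹ T`. -/
def assocInvUnit (F : A ⥤ᵖ B) (G : B ⥤ᵖ C) {T : C ⥤ᵖ C} (u : Pseudofunctor.id C ⟶ T) :
    preWhUnit (F.comp G) u ≫ assocInv F G T ≅ preWh F (preWhUnit G u) :=
  isoMk (fun X => ρ_ (u.app (G.obj (F.obj X))))
    (fun f => nat_right (u.naturality (G.map (F.map f))) _ rfl)

/-- Pseudonaturality of the inverse associators in the middle variable, along `u : 1 ⟹ T`. -/
def assocInvMiddleUnit (F : A ⥤ᵖ B) {T : B ⥤ᵖ B} (u : Pseudofunctor.id B ⟶ T) (G : B ⥤ᵖ C) :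
    postWh (preWhUnit F u) G ≫ assocInv F T G ≅ preWh F (postWhUnit u G) :=
  isoMk (fun X => ρ_ (G.map (u.app (F.obj X))))
    (fun f => nat_right (mapSq G (u.naturality (F.map f))) _ rfl)

/-- Pseudonaturality of the inverse associators in the innermost variable, along `u : 1 ⟹ T`. -/
def assocInvInnerUnit {T : A ⥤ᵖ A} (u : Pseudofunctor.id A ⟶ T) (G : A ⥤ᵖ B) (H : B ⥤ᵖ C) :
    postWh (postWhUnit u G) H ≫ assocInv T G H ≅ postWhUnit u (G.comp H) :=
  isoMk (fun X => ρ_ (H.map (G.map (u.app X))))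
    (fun f => nat_right (mapSq H (mapSq G (u.naturality f))) (mapSq (G.comp H) (u.naturality f))
      (mapSq_comp_functor G H (u.naturality f)).symm)

/-- Pseudonaturality of the associators in the middle variable, along `κ : S ⟹ 1`. -/
def assocMiddleCounit (F : A ⥤ᵖ B) {S : B ⥤ᵖ B} (κ : S ⟶ Pseudofunctor.id B) (G : B ⥤ᵖ C) :
    assoc F S G ≫ postWh (preWhCounit F κ) G ≅ preWh F (postWhCounit κ G) :=
  isoMk (fun X => λ_ (G.map (κ.app (F.obj X))))
    (fun f => nat_left (mapSq G (κ.naturality (F.map f))) _ rfl)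

/-- The two associators are inverse to each other, up to an invertible modification. -/
def assocInvAssoc (F : A ⥤ᵖ B) (G : B ⥤ᵖ C) (H : C ⥤ᵖ D) :
    assocInv F G H ≫ assoc F G H ≅ 𝟙 ((F.comp G).comp H) :=
  isoMk (fun X => λ_ (𝟙 (H.obj (G.obj (F.obj X)))))
    (fun f => nat_left (idSq (H.map (G.map (F.map f)))) _ rfl)

/-- A pentagonator. -/
def pentagon₁ (F : A ⥤ᵖ B) (G : B ⥤ᵖ C) (H : C ⥤ᵖ D) (K : D ⥤ᵖ E) :
    assocInv F (G.comp H) K ≫ preWh F (assocInv G H K) ≫ assoc F G (H.comp K) ≅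
      postWh (assoc F G H) K ≫ assocInv (F.comp G) H K :=
  isoMk (fun X => (λ_ _ ≪≫ λ_ _) ≪≫
      (ρ_ (K.map (𝟙 (H.obj (G.obj (F.obj X))))) ≪≫ K.mapId (H.obj (G.obj (F.obj X)))).symm)
    (fun f => nat_trans
      (nat_trans (nat_left (compSq (idSq (K.map (H.map (G.map (F.map f)))))
        (idSq (K.map (H.map (G.map (F.map f)))))) _ rfl)
        (nat_left (idSq (K.map (H.map (G.map (F.map f))))) _ rfl))
      (nat_symm (nat_trans (nat_right (mapSq K (idSq (H.map (G.map (F.map f))))) _ rfl)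
        (nat_mapId K (H.map (G.map (F.map f)))))))

/-- A pentagonator. -/
def pentagon₂ (F : A ⥤ᵖ B) (G : B ⥤ᵖ C) (H : C ⥤ᵖ D) (K : D ⥤ᵖ E) :
    preWh F (assoc G H K) ≫ assoc F (G.comp H) K ≫ postWh (assoc F G H) K ≅
      assoc F G (H.comp K) ≫ assoc (F.comp G) H K :=
  isoMk (fun X => (λ_ _ ≪≫ λ_ _ ≪≫ K.mapId (H.obj (G.obj (F.obj X)))) ≪≫
      (λ_ (𝟙 (K.obj (H.obj (G.obj (F.obj X)))))).symm)
    (fun f => nat_trans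
      (nat_trans (nat_left (compSq (idSq (K.map (H.map (G.map (F.map f)))))
          (mapSq K (idSq (H.map (G.map (F.map f)))))) _ rfl)
        (nat_trans (nat_left (mapSq K (idSq (H.map (G.map (F.map f))))) _ rfl)
          (nat_mapId K (H.map (G.map (F.map f))))))
      (nat_symm (nat_left (idSq (K.map (H.map (G.map (F.map f))))) _ rfl)))

/-- A pentagonator. -/
def pentagon₃ (F : A ⥤ᵖ B) (G : B ⥤ᵖ C) (H : C ⥤ᵖ D) (K : D ⥤ᵖ E) :
    assoc (F.comp G) H K ≫ postWh (assocInv F G H) K ≅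
      assocInv F G (H.comp K) ≫ preWh F (assoc G H K) ≫ assoc F (G.comp H) K :=
  isoMk (fun X => (λ_ _ ≪≫ K.mapId (H.obj (G.obj (F.obj X)))) ≪≫
      (λ_ _ ≪≫ λ_ (𝟙 (K.obj (H.obj (G.obj (F.obj X)))))).symm)
    (fun f => nat_trans
      (nat_trans (nat_left (mapSq K (idSq (H.map (G.map (F.map f))))) _ rfl)
          (nat_mapId K (H.map (G.map (F.map f)))))
      (nat_symm (nat_trans (nat_left (compSq (idSq (K.map (H.map (G.map (F.map f)))))
          (idSq (K.map (H.map (G.map (F.map f)))))) _ rfl)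
        (nat_left (idSq (K.map (H.map (G.map (F.map f))))) _ rfl))))

/-- The right triangle modification of the biadjunction obtained by transporting
along `Γ : K ≌ H`. -/
def rightTriangleTransport {K H : A ⥤ᵖ C} {N : C ⥤ᵖ A} (Γ : K ≌ H)
    (Ψ : Pseudofunctor.id C ⟶ N.comp H) (Υ : H.comp N ⟶ Pseudofunctor.id A)
    (r : (preWhUnit H Ψ ≫ assoc H N H) ≫ postWhCounit Υ H ≅ 𝟙 H) :
    (preWhUnit K (Ψ ≫ preWh N Γ.inv) ≫ assoc K N K) ≫ postWhCounit (postWh Γ.hom N ≫ Υ) K ≅ 𝟙 K :=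
  whiskerRightIso (whiskerRightIso (preWhUnitComp K Ψ (preWh N Γ.inv)) (assoc K N K))
      (postWhCounit (postWh Γ.hom N ≫ Υ) K) ≪⊗≫
  whiskerLeftIso (preWhUnit K Ψ ≫ preWh K (preWh N Γ.inv) ≫ assoc K N K)
      (postWhCounitComp (postWh Γ.hom N) Υ K) ≪⊗≫
  whiskerLeftIso (preWhUnit K Ψ) (whiskerRightIso (assocOuter K N Γ.inv)
      (postWh (postWh Γ.hom N) K ≫ postWhCounit Υ K)) ≪⊗≫
  whiskerLeftIso (preWhUnit K Ψ ≫ assoc K N H)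
      (whiskerRightIso (exchange (postWh Γ.hom N) Γ.inv) (postWhCounit Υ K)) ≪⊗≫
  whiskerLeftIso (preWhUnit K Ψ ≫ assoc K N H ≫ postWh (postWh Γ.hom N) H)
      (counitExchange Υ Γ.inv) ≪⊗≫
  whiskerLeftIso (preWhUnit K Ψ) (whiskerRightIso (assocInner Γ.hom N H)
      (postWhCounit Υ H ≫ Γ.inv)) ≪⊗≫
  whiskerRightIso (unitExchange Γ.hom Ψ) (assoc H N H ≫ postWhCounit Υ H ≫ Γ.inv) ≪⊗≫
  whiskerLeftIso Γ.hom (whiskerRightIso r Γ.inv) ≪⊗≫ Γ.unit.symm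

/-- A biadjunction `L ⊣ R` between bicategories: a unit, a counit and invertible modifications
filling the two triangles (no coherence law is imposed on these modifications). -/
structure Biadjunction (L : A ⥤ᵖ B) (R : B ⥤ᵖ A) where
  unit : Pseudofunctor.id A ⟶ L.comp R
  counit : R.comp L ⟶ Pseudofunctor.id B
  leftTriangle : (postWhUnit unit L ≫ assocInv L R L) ≫ preWhCounit L counit ≅ 𝟙 L
  rightTriangle : (preWhUnit R unit ≫ assoc R L R) ≫ postWhCounit counit R ≅ 𝟙 R

/-! ### Inverters -/

section Inverter

variable {X₀ X₁ X₂ : A} {f₁ f₂ : X₁ ⟶ X₂}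

/-- The inverter cones with apex `X` over `φ`: the 1-morphisms `f : X ⟶ X₁` such that the
whiskering of `φ` by `f` is invertible. They form a full subcategory of `X ⟶ X₁`. -/
def invCone (φ : f₁ ⟶ f₂) (X : A) : ObjectProperty (X ⟶ X₁) := fun f => IsIso (f ◁ φ)

theorem invCone_comp {φ : f₁ ⟶ f₂} {f₀ : X₀ ⟶ X₁} (h : IsIso (f₀ ◁ φ)) {X : A} (g : X ⟶ X₀) :
    invCone φ X (g ≫ f₀) := by
  unfold invCone
  rw [comp_whiskerLeft]
  infer_instance

/-- Composition with an inverter cone `f₀`, as a functor from `X ⟶ X₀` to the category of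
inverter cones with apex `X`. -/
def invConeFunctor {φ : f₁ ⟶ f₂} {f₀ : X₀ ⟶ X₁} (h : IsIso (f₀ ◁ φ)) (X : A) :
    (X ⟶ X₀) ⥤ (invCone φ X).FullSubcategory :=
  (invCone φ X).lift (postcomp X f₀) (fun g => invCone_comp h g)

/-- `(X₀, f₀)` is an inverter of the 2-morphism `φ`. -/
structure IsInverter (φ : f₁ ⟶ f₂) (f₀ : X₀ ⟶ X₁) : Prop where
  isIso : IsIso (f₀ ◁ φ)
  isEquivalence : ∀ X : A, (invConeFunctor isIso X).IsEquivalence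

end Inverter

/-! ### The data attached to a triangle of biadjunctions -/

section Triangle

variable {F : A ⥤ᵖ B} {L : B ⥤ᵖ A} {G : B ⥤ᵖ C} {H : A ⥤ᵖ C} {N : C ⥤ᵖ A}
  (a : Biadjunction L F) (b : Biadjunction N H) (Γ : F.comp G ≌ H)

/-- `Ψ' : 1 ⟹ (GF)N`. -/
def psi' : Pseudofunctor.id C ⟶ N.comp (F.comp G) := b.unit ≫ preWh N Γ.inv

/-- `Υ' : N(GF) ⟹ 1`. -/
def upsilon' : (F.comp G).comp N ⟶ Pseudofunctor.id A := postWh Γ.hom N ≫ b.counit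

/-- `Φ' : G ⟹ (GF)L`. -/
def phi' (G : B ⥤ᵖ C) : G ⟶ L.comp (F.comp G) := postWhUnit a.unit G ≫ assocInv L F G

/-- `Θ : NG ⟹ L`. -/
def theta : G.comp N ⟶ L :=
  (postWh (phi' a G) N ≫ assocInv L (F.comp G) N) ≫ preWhCounit L (upsilon' b Γ)

/-- `Θ' : (FN)G ⟹ FL`. -/
def theta' : G.comp (N.comp F) ⟶ L.comp F := assoc G N F ≫ postWh (theta a b Γ) F

/-- `Ψ'' : 1 ⟹ G(FN)`. -/
def psi'' : Pseudofunctor.id C ⟶ (N.comp F).comp G := psi' b Γ ≫ assoc N F G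

/-- `Ξ' : FN ⟹ ((FN)G)(FN)`. -/
def xi' : N.comp F ⟶ (N.comp F).comp (G.comp (N.comp F)) :=
  postWhUnit (psi'' b Γ) (N.comp F) ≫ assocInv (N.comp F) G (N.comp F)

/-- `Ξ : FN ⟹ (FL)(FN)`. -/
def xi : N.comp F ⟶ (N.comp F).comp (L.comp F) :=
  xi' b Γ ≫ preWh (N.comp F) (theta' a b Γ)

/-- `Θ'' : ((FL)(FN))G ⟹ (FL)(FL)`. -/
def theta'' : G.comp ((N.comp F).comp (L.comp F)) ⟶ (L.comp F).comp (L.comp F) :=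
  assoc G (N.comp F) (L.comp F) ≫ postWh (theta' a b Γ) (L.comp F)

/-- `φ₁ : Θ'' ∘ (Φ_{FN})_G ≅ Φ_{FL} ∘ Θ'`. -/
def phi₁ : preWh G (preWhUnit (N.comp F) a.unit) ≫ theta'' a b Γ ≅
    theta' a b Γ ≫ preWhUnit (L.comp F) a.unit :=
  (α_ (preWh G (preWhUnit (N.comp F) a.unit)) (assoc G (N.comp F) (L.comp F))
    (postWh (theta' a b Γ) (L.comp F))).symm ≪≫
  whiskerRightIso (assocUnit G (N.comp F) a.unit) (postWh (theta' a b Γ) (L.comp F)) ≪≫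
  unitExchange (theta' a b Γ) a.unit

/-- Whiskering of the composite defining `Ψ''`. -/
def preWhUnitPsi'' : preWhUnit G (psi'' b Γ) ≅
    preWhUnit G (psi' b Γ) ≫ preWh G (assoc N F G) :=
  preWhUnitComp G (psi' b Γ) (assoc N F G)

/-- Whiskering of the composite defining `Ξ'`. -/
def preWhXi' : preWh G (xi' b Γ) ≅
    preWh G (postWhUnit (psi'' b Γ) (N.comp F)) ≫ preWh G (assocInv (N.comp F) G (N.comp F)) :=
  preWhComp G (postWhUnit (psi'' b Γ) (N.comp F)) (assocInv (N.comp F) G (N.comp F))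

/-- Whiskering of the composite defining `Ξ`. -/
def preWhXi : preWh G (xi a b Γ) ≅
    preWh G (xi' b Γ) ≫ preWh G (preWh (N.comp F) (theta' a b Γ)) :=
  preWhComp G (xi' b Γ) (preWh (N.comp F) (theta' a b Γ))

/-- Whiskering of the composite defining `Θ'`. -/
def postWhTheta' : postWh (theta' a b Γ) G ≅
    postWh (assoc G N F) G ≫ postWh (postWh (theta a b Γ) F) G :=
  postWhComp (assoc G N F) (postWh (theta a b Γ) F) G

/-- Whiskering of the composite defining `Θ`. -/
def postWhTheta (K : A ⥤ᵖ C) : postWh (theta a b Γ) K ≅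
    (postWh (postWh (phi' a G) N) K ≫ postWh (assocInv L (F.comp G) N) K) ≫
      postWh (preWhCounit L (upsilon' b Γ)) K :=
  postWhComp (postWh (phi' a G) N ≫ assocInv L (F.comp G) N) (preWhCounit L (upsilon' b Γ)) K ≪≫
    whiskerRightIso (postWhComp (postWh (phi' a G) N) (assocInv L (F.comp G) N) K)
      (postWh (preWhCounit L (upsilon' b Γ)) K)

/-- `A ∘ Φ' ≅ GΦ`. -/
def phi'Assoc (G : B ⥤ᵖ C) : phi' a G ≫ assoc L F G ≅ postWhUnit a.unit G :=
  α_ (postWhUnit a.unit G) (assocInv L F G) (assoc L F G) ≪≫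
    whiskerLeftIso (postWhUnit a.unit G) (assocInvAssoc L F G) ≪≫ ρ_ (postWhUnit a.unit G)

/-- The invertible modification `GΘ' ∘ A ∘ Ψ''_G ≅ GΦ`. -/
def phi₂'' : (preWhUnit G (psi'' b Γ) ≫ assoc G (N.comp F) G) ≫ postWh (theta' a b Γ) G ≅
    postWhUnit a.unit G :=
  whiskerRightIso (whiskerRightIso (preWhUnitPsi'' b Γ)
      (assoc G (N.comp F) G)) (postWh (theta' a b Γ) G) ≪⊗≫
  whiskerLeftIso (preWhUnit G (psi' b Γ) ≫ preWh G (assoc N F G) ≫ assoc G (N.comp F) G)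
      (postWhTheta' a b Γ) ≪⊗≫
  whiskerLeftIso (preWhUnit G (psi' b Γ)) (whiskerRightIso (pentagon₂ G N F G)
      (postWh (postWh (theta a b Γ) F) G)) ≪⊗≫
  whiskerLeftIso (preWhUnit G (psi' b Γ) ≫ assoc G N (F.comp G))
      (assocInner (theta a b Γ) F G) ≪⊗≫
  whiskerLeftIso (preWhUnit G (psi' b Γ) ≫ assoc G N (F.comp G))
      (whiskerRightIso (postWhTheta a b Γ (F.comp G)) (assoc L F G)) ≪⊗≫
  whiskerLeftIso (preWhUnit G (psi' b Γ)) (whiskerRightIso (assocInner (phi' a G) N (F.comp G))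
      (postWh (assocInv L (F.comp G) N) (F.comp G) ≫
        postWh (preWhCounit L (upsilon' b Γ)) (F.comp G) ≫ assoc L F G)) ≪⊗≫
  whiskerRightIso (unitExchange (phi' a G) (psi' b Γ)) (assoc (L.comp (F.comp G)) N (F.comp G) ≫
      postWh (assocInv L (F.comp G) N) (F.comp G) ≫
        postWh (preWhCounit L (upsilon' b Γ)) (F.comp G) ≫ assoc L F G) ≪⊗≫
  whiskerLeftIso (phi' a G ≫ preWhUnit (L.comp (F.comp G)) (psi' b Γ))
      (whiskerRightIso (pentagon₃ L (F.comp G) N (F.comp G))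
        (postWh (preWhCounit L (upsilon' b Γ)) (F.comp G) ≫ assoc L F G)) ≪⊗≫
  whiskerLeftIso (phi' a G) (whiskerRightIso (assocInvUnit L (F.comp G) (psi' b Γ))
      (preWh L (assoc (F.comp G) N (F.comp G)) ≫ assoc L ((F.comp G).comp N) (F.comp G) ≫
        postWh (preWhCounit L (upsilon' b Γ)) (F.comp G) ≫ assoc L F G)) ≪⊗≫
  whiskerLeftIso (phi' a G ≫ preWh L (preWhUnit (F.comp G) (psi' b Γ)) ≫
      preWh L (assoc (F.comp G) N (F.comp G)))
      (whiskerRightIso (assocMiddleCounit L (upsilon' b Γ) (F.comp G)) (assoc L F G)) ≪⊗≫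
  whiskerLeftIso (phi' a G)
      (whiskerRightIso (preWhComp L (preWhUnit (F.comp G) (psi' b Γ))
        (assoc (F.comp G) N (F.comp G))).symm
        (preWh L (postWhCounit (upsilon' b Γ) (F.comp G)) ≫ assoc L F G)) ≪⊗≫
  whiskerLeftIso (phi' a G)
      (whiskerRightIso ((preWhComp L (preWhUnit (F.comp G) (psi' b Γ) ≫
          assoc (F.comp G) N (F.comp G)) (postWhCounit (upsilon' b Γ) (F.comp G))).symm ≪≫
        preWhIso L (rightTriangleTransport Γ b.unit b.counit b.rightTriangle) ≪≫
        preWhId L (F.comp G)) (assoc L F G)) ≪⊗≫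
  phi'Assoc a G

/-- The invertible modification `((FN)G)Θ' ∘ A ∘ Ξ'_G ≅ ((FN)G)Φ`. -/
def phi₂' : preWh G (xi' b Γ) ≫ assoc G (N.comp F) (G.comp (N.comp F)) ≫
      postWh (theta' a b Γ) (G.comp (N.comp F)) ≅
    postWhUnit a.unit (G.comp (N.comp F)) :=
  whiskerRightIso (preWhXi' b Γ) (assoc G (N.comp F) (G.comp (N.comp F)) ≫
        postWh (theta' a b Γ) (G.comp (N.comp F))) ≪⊗≫
  whiskerRightIso (assocInvMiddleUnit G (psi'' b Γ) (N.comp F)).symm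
      (preWh G (assocInv (N.comp F) G (N.comp F)) ≫ assoc G (N.comp F) (G.comp (N.comp F)) ≫
        postWh (theta' a b Γ) (G.comp (N.comp F))) ≪⊗≫
  whiskerLeftIso (postWh (preWhUnit G (psi'' b Γ)) (N.comp F))
      (whiskerRightIso (pentagon₁ G (N.comp F) G (N.comp F))
        (postWh (theta' a b Γ) (G.comp (N.comp F)))) ≪⊗≫
  whiskerLeftIso (postWh (preWhUnit G (psi'' b Γ)) (N.comp F) ≫
      postWh (assoc G (N.comp F) G) (N.comp F))
      (assocInvInner (theta' a b Γ) G (N.comp F)) ≪⊗≫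
  whiskerRightIso (postWhComp (preWhUnit G (psi'' b Γ)) (assoc G (N.comp F) G) (N.comp F)).symm
      (postWh (postWh (theta' a b Γ) G) (N.comp F) ≫ assocInv (L.comp F) G (N.comp F)) ≪⊗≫
  whiskerRightIso ((postWhComp (preWhUnit G (psi'' b Γ) ≫ assoc G (N.comp F) G)
        (postWh (theta' a b Γ) G) (N.comp F)).symm ≪≫ postWhIso (phi₂'' a b Γ) (N.comp F))
      (assocInv (L.comp F) G (N.comp F)) ≪⊗≫
  assocInvInnerUnit a.unit G (N.comp F)

/-- `φ₂ : Θ'' ∘ Ξ_G ≅ (FL)Φ ∘ Θ'`. -/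
def phi₂ : preWh G (xi a b Γ) ≫ theta'' a b Γ ≅
    theta' a b Γ ≫ postWhUnit a.unit (L.comp F) :=
  whiskerRightIso (preWhXi a b Γ)
      (assoc G (N.comp F) (L.comp F) ≫ postWh (theta' a b Γ) (L.comp F)) ≪⊗≫
  whiskerLeftIso (preWh G (xi' b Γ)) (whiskerRightIso (assocOuter G (N.comp F) (theta' a b Γ))
      (postWh (theta' a b Γ) (L.comp F))) ≪⊗≫
  whiskerLeftIso (preWh G (xi' b Γ) ≫ assoc G (N.comp F) (G.comp (N.comp F)))
      (exchange (theta' a b Γ) (theta' a b Γ)) ≪⊗≫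
  whiskerRightIso (phi₂' a b Γ) (preWh (L.comp F) (theta' a b Γ)) ≪⊗≫
  postUnitExchange a.unit (theta' a b Γ)

end Triangle

end
end BiTri

/-! An inverter `f₀` has two properties: whiskering with `f₀` is bijective on 2-morphisms
(`FullyFaithful`), and every inverter cone factors through `f₀` up to isomorphism
(`IsInverter.exists_lift`). Everything is built by factoring cones and then checked after whiskering
with fully faithful 1-morphisms.

For `M`: naturality of `μ` makes `Λ_C` followed by `FN(f)` a cone over the next component of `μ`, so
it factors through the next `Λ`; this gives `M(f)`. The 2-cells and coherence of `M` are lifted from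
those of `FN` (`SubData`). The same lifting applied to an arbitrary cone over `μ` shows that a
pointwise inverter is an inverter in the bicategory of pseudofunctors (`isInverter_of_app`).

For the biadjunction: `G(Λ)` is an inverter of `G(μ)` and `Ψ''` is a cone over it, whence a unit `η`
with `i : G(Λ) ∘ η ≅ Ψ''`. The unit `Φ` is an inverter of `ν`, and `Θ' ∘ Λ_G` is a cone because `φ₁`
and `φ₂` turn `ν * Θ'` into `Θ'' * μ_G`, which `Λ_G` inverts; whence a counit `κ` with `j : Φ ∘ κ ≅
Θ' ∘ Λ_G`. Since the triangle modifications obey no law, it suffices to produce them after composing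
with fully faithful transformations. After `G(Φ)`, the right triangle becomes `G(Θ') ∘ A ∘ Ψ''_G ≅
G(Φ)`, which is `φ₂''`. After `Λ` and `Φ_{FN}`, the left triangle becomes `Ξ ∘ Λ ≅ Φ_{FN} ∘ Λ`,
which is the inverse of `μ * Λ`. -/

namespace BiTri

/-! ### Fully faithful 1-morphisms and inverters. -/

section FullyFaithful

variable {A : Type u₁} [Bicategory.{w₁, v₁} A] {X Y : A}

/-- A 1-morphism `p` is fully faithful if whiskering with `p` is bijective on 2-morphisms. -/
structure FullyFaithful (p : X ⟶ Y) : Prop where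
  injective : ∀ {W : A} {f g : W ⟶ X} {η θ : f ⟶ g}, η ▷ p = θ ▷ p → η = θ
  surjective : ∀ {W : A} {f g : W ⟶ X} (h : f ≫ p ⟶ g ≫ p), ∃ η : f ⟶ g, η ▷ p = h

namespace FullyFaithful

variable {p : X ⟶ Y} (hp : FullyFaithful p) {W : A} {f g : W ⟶ X}

/-- The 2-morphism whose whiskering with `p` is `h`. -/
noncomputable def lift (h : f ≫ p ⟶ g ≫ p) : f ⟶ g := (hp.surjective h).choose

theorem lift_whiskerRight (h : f ≫ p ⟶ g ≫ p) : hp.lift h ▷ p = h :=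
  (hp.surjective h).choose_spec

/-- The invertible 2-morphism whose whiskering with `p` is `e`. -/
@[simps]
noncomputable def liftIso (e : f ≫ p ≅ g ≫ p) : f ≅ g where
  hom := hp.lift e.hom
  inv := hp.lift e.inv
  hom_inv_id := hp.injective (by simp [lift_whiskerRight])
  inv_hom_id := hp.injective (by simp [lift_whiskerRight])

end FullyFaithful

variable {X₀ X₁ X₂ : A} {f₁ f₂ : X₁ ⟶ X₂} {φ : f₁ ⟶ f₂} {f₀ : X₀ ⟶ X₁}

theorem IsInverter.fullyFaithful (h : IsInverter φ f₀) : FullyFaithful f₀ where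
  injective {W f g η θ} e := by
    have := h.isEquivalence W
    apply (invConeFunctor h.isIso W).map_injective
    ext
    exact e
  surjective {W f g} k := by
    have := h.isEquivalence W
    refine ⟨(invConeFunctor h.isIso W).preimage ⟨k⟩, ?_⟩
    exact congrArg (·.hom) ((invConeFunctor h.isIso W).map_preimage ⟨k⟩)

theorem IsInverter.exists_lift (h : IsInverter φ f₀) {W : A} (f : W ⟶ X₁) (hf : IsIso (f ◁ φ)) :
    ∃ g : W ⟶ X₀, Nonempty (g ≫ f₀ ≅ f) := by
  have := h.isEquivalence W
  let c : (invCone φ W).FullSubcategory := ⟨f, hf⟩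
  exact ⟨(invConeFunctor h.isIso W).objPreimage c,
    ⟨(invCone φ W).ι.mapIso ((invConeFunctor h.isIso W).objObjPreimageIso c)⟩⟩

/-- Converse to the two preceding results: cones form a full subcategory, so the equivalence splits
into bijectivity on 2-morphisms and factorization of objects. -/
theorem isInverter_of_fullyFaithful (h : IsIso (f₀ ◁ φ)) (hf : FullyFaithful f₀)
    (hs : ∀ {W : A} (f : W ⟶ X₁), IsIso (f ◁ φ) → ∃ g : W ⟶ X₀, Nonempty (g ≫ f₀ ≅ f)) :
    IsInverter φ f₀ where
  isIso := h
  isEquivalence W :=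
    { faithful := ⟨fun {f g η θ} e => hf.injective (congrArg (·.hom) e)⟩
      full := ⟨fun {f g} k => by
        obtain ⟨η, e⟩ := hf.surjective k.hom
        exact ⟨η, by ext; exact e⟩⟩
      essSurj := ⟨fun c => by
        obtain ⟨g, ⟨e⟩⟩ := hs c.obj c.property
        exact ⟨g, ⟨(invCone φ W).isoMk e⟩⟩⟩ }

end FullyFaithful

/-! ### Pseudofunctors and transformations lifted through pointwise fully faithful 1-morphisms. -/

section Pointwise

variable {C : Type u₁} [Bicategory.{w₁, v₁} C] {B : Type u₂} [Bicategory.{w₂, v₂} B]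

/-- The interchange law in associator normal form. Used as a rewrite rule, it and the next two move
the inverse of a square to the right past other 2-morphisms, so that both sides of a coherence law
reach the same form. -/
theorem whiskerRight_inv_exchange_assoc {X Y Y' Z W : B} {p : X ⟶ Y} {q : Y ⟶ Z} {r : X ⟶ Y'}
    {t : Y' ⟶ Z} (s : p ≫ q ≅ r ≫ t) {k l : Z ⟶ W} (x : k ⟶ l) {z : X ⟶ W}
    (y : p ≫ q ≫ l ⟶ z) :
    s.inv ▷ k ≫ (α_ _ _ _).hom ≫ p ◁ q ◁ x ≫ y =
      (α_ _ _ _).hom ≫ r ◁ t ◁ x ≫ (α_ _ _ _).inv ≫ s.inv ▷ l ≫ (α_ _ _ _).hom ≫ y := by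
  have := whisker_exchange s.inv x
  simp only [comp_whiskerLeft, ← cancel_mono (α_ p q l).hom] at this
  simpa using (this =≫ y).symm

theorem whiskerLeft_inv_exchange_assoc {W X Y Y' Z : B} {q : X ⟶ Y} {k : Y ⟶ Z} {r : X ⟶ Y'}
    {t : Y' ⟶ Z} (s : q ≫ k ≅ r ≫ t) {f g : W ⟶ X} (η : f ⟶ g) {z : W ⟶ Z}
    (y : (g ≫ q) ≫ k ⟶ z) :
    f ◁ s.inv ≫ (α_ _ _ _).inv ≫ η ▷ q ▷ k ≫ y =
      (α_ _ _ _).inv ≫ η ▷ r ▷ t ≫ (α_ _ _ _).hom ≫ g ◁ s.inv ≫ (α_ _ _ _).inv ≫ y := by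
  have := whisker_exchange η s.inv
  simp only [whiskerRight_comp, ← cancel_mono (α_ g q k).inv] at this
  simpa using this =≫ y

/-- The variant for an `η` with composite source, where the whiskering by `f₁ ≫ f₂` appears already
expanded. -/
theorem whiskerLeft_whiskerLeft_inv_exchange_assoc {V W X Y Y' Z : B} {q : X ⟶ Y} {k : Y ⟶ Z}
    {r : X ⟶ Y'} {t : Y' ⟶ Z} (s : q ≫ k ≅ r ≫ t) {f₁ : V ⟶ W} {f₂ : W ⟶ X} {g : V ⟶ X}
    (η : f₁ ≫ f₂ ⟶ g) {z : V ⟶ Z} (y : (g ≫ q) ≫ k ⟶ z) :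
    f₁ ◁ f₂ ◁ s.inv ≫ (α_ _ _ _).inv ≫ (α_ _ _ _).inv ≫ η ▷ q ▷ k ≫ y =
      (α_ _ _ _).inv ≫ (α_ _ _ _).inv ≫ η ▷ r ▷ t ≫ (α_ _ _ _).hom ≫ g ◁ s.inv ≫
        (α_ _ _ _).inv ≫ y := by
  simp [← whiskerLeft_inv_exchange_assoc]

/-- Objects with fully faithful 1-morphisms into the values of a pseudofunctor `Q`,
and 1-morphisms between them compatible with those of `Q` up to invertible 2-morphisms. -/
structure SubData (Q : C ⥤ᵖ B) where
  obj : C → B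
  incl : ∀ c, obj c ⟶ Q.obj c
  fullyFaithful : ∀ c, FullyFaithful (incl c)
  map : ∀ {c d : C}, (c ⟶ d) → (obj c ⟶ obj d)
  square : ∀ {c d : C} (f : c ⟶ d), map f ≫ incl d ≅ incl c ≫ Q.map f

namespace SubData

variable {Q : C ⥤ᵖ B} (S : SubData Q)

/-- The action on 2-morphisms. -/
noncomputable def map₂ {c d : C} {f g : c ⟶ d} (η : f ⟶ g) : S.map f ⟶ S.map g :=
  (S.fullyFaithful d).lift ((S.square f).hom ≫ S.incl c ◁ Q.map₂ η ≫ (S.square g).inv)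

theorem map₂_whiskerRight {c d : C} {f g : c ⟶ d} (η : f ⟶ g) :
    S.map₂ η ▷ S.incl d = (S.square f).hom ≫ S.incl c ◁ Q.map₂ η ≫ (S.square g).inv :=
  (S.fullyFaithful d).lift_whiskerRight _

/-- The unit constraints. -/
noncomputable def mapId (c : C) : S.map (𝟙 c) ≅ 𝟙 (S.obj c) :=
  (S.fullyFaithful c).liftIso
    (S.square (𝟙 c) ≪≫ whiskerLeftIso (S.incl c) (Q.mapId c) ≪≫ ρ_ _ ≪≫ (λ_ _).symm)

theorem mapId_whiskerRight (c : C) : (S.mapId c).hom ▷ S.incl c =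
    (S.square (𝟙 c)).hom ≫ S.incl c ◁ (Q.mapId c).hom ≫ (ρ_ _).hom ≫ (λ_ _).inv :=
  (S.fullyFaithful c).lift_whiskerRight _

/-- The composition constraints. -/
noncomputable def mapComp {c d e : C} (f : c ⟶ d) (g : d ⟶ e) :
    S.map (f ≫ g) ≅ S.map f ≫ S.map g :=
  (S.fullyFaithful e).liftIso
    (S.square (f ≫ g) ≪≫ whiskerLeftIso (S.incl c) (Q.mapComp f g) ≪≫ (α_ _ _ _).symm ≪≫
      whiskerRightIso (S.square f).symm (Q.map g) ≪≫ α_ _ _ _ ≪≫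
      whiskerLeftIso (S.map f) (S.square g).symm ≪≫ (α_ _ _ _).symm)

theorem mapComp_whiskerRight {c d e : C} (f : c ⟶ d) (g : d ⟶ e) :
    (S.mapComp f g).hom ▷ S.incl e =
      (S.square (f ≫ g)).hom ≫ S.incl c ◁ (Q.mapComp f g).hom ≫ (α_ _ _ _).inv ≫
        (S.square f).inv ▷ Q.map g ≫ (α_ _ _ _).hom ≫ S.map f ◁ (S.square g).inv ≫
        (α_ _ _ _).inv :=
  (S.fullyFaithful e).lift_whiskerRight _

theorem mapComp_inv_whiskerRight {c d e : C} (f : c ⟶ d) (g : d ⟶ e) :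
    (S.mapComp f g).inv ▷ S.incl e =
      (α_ _ _ _).hom ≫ S.map f ◁ (S.square g).hom ≫ (α_ _ _ _).inv ≫
        (S.square f).hom ▷ Q.map g ≫ (α_ _ _ _).hom ≫
        S.incl c ◁ (Q.mapComp f g).inv ≫ (S.square (f ≫ g)).inv := by
  refine ((S.fullyFaithful e).lift_whiskerRight _).trans ?_
  simp

/-- The pseudofunctor determined by the data `S`. -/
noncomputable def pseudofunctor : C ⥤ᵖ B where
  obj := S.obj
  map := S.map
  map₂ := S.map₂
  -- Each axiom is checked after whiskering with `S.incl`. There every structure 2-morphism is that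
  -- of `Q` conjugated by squares, so the axiom reduces to the one for `Q`; no coherence of the
  -- squares themselves is needed.
  map₂_id f := (S.fullyFaithful _).injective (by simp [map₂_whiskerRight])
  map₂_comp η θ := (S.fullyFaithful _).injective (by simp [map₂_whiskerRight])
  mapId := S.mapId
  mapComp := S.mapComp
  map₂_whisker_left f g h η := (S.fullyFaithful _).injective (by
    simp [map₂_whiskerRight, mapComp_whiskerRight, mapComp_inv_whiskerRight, whiskerRight_inv_exchange_assoc])
  map₂_whisker_right η h := (S.fullyFaithful _).injective (by
    simp [map₂_whiskerRight, mapComp_whiskerRight, mapComp_inv_whiskerRight,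
      whiskerLeft_inv_exchange_assoc])
  map₂_associator f g h := (S.fullyFaithful _).injective (by
    simp [map₂_whiskerRight, mapComp_whiskerRight, mapComp_inv_whiskerRight,
      whiskerLeft_inv_exchange_assoc]
    rw [associator_naturality_left_assoc, whiskerRight_inv_exchange_assoc]
    simp)
  map₂_left_unitor f := (S.fullyFaithful _).injective (by
    simp [map₂_whiskerRight, mapComp_whiskerRight, mapId_whiskerRight,
      whiskerLeft_inv_exchange_assoc])
  map₂_right_unitor f := (S.fullyFaithful _).injective (by
    simp [map₂_whiskerRight, mapComp_whiskerRight, mapId_whiskerRight,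
      whiskerRight_inv_exchange_assoc])

theorem square_naturality {c d : C} {f g : c ⟶ d} (η : f ⟶ g) :
    S.map₂ η ▷ S.incl d ≫ (S.square g).hom = (S.square f).hom ≫ S.incl c ◁ Q.map₂ η := by
  simp [map₂_whiskerRight]

theorem square_id (c : C) :
    (S.square (𝟙 c)).hom ≫ S.incl c ◁ (Q.mapId c).hom =
      (S.mapId c).hom ▷ S.incl c ≫ (λ_ _).hom ≫ (ρ_ _).inv := by
  simp [mapId_whiskerRight]

theorem square_comp {c d e : C} (f : c ⟶ d) (g : d ⟶ e) :
    (S.square (f ≫ g)).hom ≫ S.incl c ◁ (Q.mapComp f g).hom =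
      (S.mapComp f g).hom ▷ S.incl e ≫ (α_ _ _ _).hom ≫ S.map f ◁ (S.square g).hom ≫
        (α_ _ _ _).inv ≫ (S.square f).hom ▷ Q.map g ≫ (α_ _ _ _).hom := by
  simp [mapComp_whiskerRight]

/-- The inclusion of the pseudofunctor determined by the data `S`. -/
noncomputable def inclusion : S.pseudofunctor ⟶ Q where
  app := S.incl
  naturality := S.square
  naturality_naturality η := S.square_naturality η
  naturality_id c := S.square_id c
  naturality_comp f g := S.square_comp f g

end SubData

variable {P Q : C ⥤ᵖ B}

/-- Interchange slides `sl` past `m₁`, and `sl` is invertible, so it cancels from the pasting `e`.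
With `l₂` fully faithful, this recovers the modification axiom for lifted components. -/
theorem whisker_square_of_pasting {W₁ W₂ P₁ P₂ Q₁ Q₂ : B} {w : W₁ ⟶ W₂} {p : P₁ ⟶ P₂}
    {q : Q₁ ⟶ Q₂}
    {f₁ g₁ : W₁ ⟶ P₁} {f₂ g₂ : W₂ ⟶ P₂} {l₁ : P₁ ⟶ Q₁} {l₂ : P₂ ⟶ Q₂}
    (sf : w ≫ f₂ ≅ f₁ ≫ p) (sg : w ≫ g₂ ≅ g₁ ≫ p) (sl : p ≫ l₂ ≅ l₁ ≫ q)
    (m₁ : f₁ ⟶ g₁) (m₂ : f₂ ⟶ g₂)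
    (e : w ◁ (m₂ ▷ l₂) ≫ (α_ _ _ _).inv ≫ sg.hom ▷ l₂ ≫ (α_ _ _ _).hom ≫ g₁ ◁ sl.hom ≫
        (α_ _ _ _).inv =
      ((α_ _ _ _).inv ≫ sf.hom ▷ l₂ ≫ (α_ _ _ _).hom ≫ f₁ ◁ sl.hom ≫ (α_ _ _ _).inv) ≫
        (m₁ ▷ l₁) ▷ q) :
    (w ◁ m₂ ≫ sg.hom) ▷ l₂ = (sf.hom ≫ m₁ ▷ p) ▷ l₂ := by
  rw [← cancel_epi (α_ _ _ _).inv, ← cancel_mono (α_ _ _ _).hom, ← cancel_mono (g₁ ◁ sl.hom),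
    ← cancel_mono (α_ _ _ _).inv]
  have e' := whisker_exchange m₁ sl.hom
  rw [whiskerRight_comp, whiskerRight_comp, ← cancel_mono (α_ _ _ _).inv] at e'
  simp only [Category.assoc, Iso.hom_inv_id, Category.comp_id] at e'
  simpa [e'] using e

/-- Components are lifted one object at a time; the modification axiom for the lifts holds because
it holds after whiskering with `Λ`. -/
theorem fullyFaithful_of_app {Λ : P ⟶ Q} (h : ∀ c, FullyFaithful (Λ.app c)) :
    FullyFaithful Λ where
  injective {W f g η θ} e := by
    ext c
    exact (h c).injective (congrArg (fun m => m.as.app c) e)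
  surjective {W f g} k := by
    refine ⟨⟨⟨fun c => (h c).lift (k.as.app c), fun {c d} u => (h d).injective ?_⟩⟩, ?_⟩
    · have e := k.as.naturality u
      change W.map u ◁ k.as.app d ≫ (α_ _ _ _).inv ≫ (g.naturality u).hom ▷ Λ.app d ≫
          (α_ _ _ _).hom ≫ g.app c ◁ (Λ.naturality u).hom ≫ (α_ _ _ _).inv =
        ((α_ _ _ _).inv ≫ (f.naturality u).hom ▷ Λ.app d ≫
          (α_ _ _ _).hom ≫ f.app c ◁ (Λ.naturality u).hom ≫ (α_ _ _ _).inv) ≫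
          k.as.app c ▷ Q.map u at e
      rw [← (h c).lift_whiskerRight (k.as.app c), ← (h d).lift_whiskerRight (k.as.app d)] at e
      exact whisker_square_of_pasting _ _ _ _ _ e
    · ext c
      exact (h c).lift_whiskerRight _

/-! ### Factoring a pseudonatural transformation from pointwise factorizations. -/

section Lift

variable {W : C ⥤ᵖ B} {Λ : P ⟶ Q} (h : ∀ c, FullyFaithful (Λ.app c)) (γ : W ⟶ Q)
  (k : ∀ c, W.obj c ⟶ P.obj c) (e : ∀ c, k c ≫ Λ.app c ≅ γ.app c)

/-- The naturality constraints of `liftTrans`. -/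
noncomputable def liftNaturality {c d : C} (f : c ⟶ d) :
    W.map f ≫ k d ≅ k c ≫ P.map f :=
  (h d).liftIso (α_ _ _ _ ≪≫ whiskerLeftIso (W.map f) (e d) ≪≫ γ.naturality f ≪≫
    whiskerRightIso (e c).symm (Q.map f) ≪≫ α_ _ _ _ ≪≫
    whiskerLeftIso (k c) (Λ.naturality f).symm ≪≫ (α_ _ _ _).symm)

theorem liftNaturality_whiskerRight {c d : C} (f : c ⟶ d) :
    (liftNaturality h γ k e f).hom ▷ Λ.app d =
      (α_ _ _ _).hom ≫ W.map f ◁ (e d).hom ≫ (γ.naturality f).hom ≫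
        (e c).inv ▷ Q.map f ≫ (α_ _ _ _).hom ≫ k c ◁ (Λ.naturality f).inv ≫ (α_ _ _ _).inv :=
  (h d).lift_whiskerRight _

/-- A pointwise factorization of a pseudonatural transformation through a pointwise fully
faithful one is pseudonatural. -/
noncomputable def liftTrans : W ⟶ P where
  app := k
  naturality := liftNaturality h γ k e
  -- After whiskering with `Λ`, each axiom splits into the axiom for `Λ` (as `e₁`), the axiom for
  -- `γ`, and interchanges that carry the isomorphisms `e` past the structure 2-morphisms.
  naturality_naturality {c d f g} η := (h _).injective (by
    have e₁ : (Λ.naturality f).inv ≫ P.map₂ η ▷ Λ.app d =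
        Λ.app c ◁ Q.map₂ η ≫ (Λ.naturality g).inv := by
      rw [Iso.inv_comp_eq, ← Category.assoc, Iso.eq_comp_inv]
      exact Λ.naturality_naturality η
    simp only [comp_whiskerRight, liftNaturality_whiskerRight, Category.assoc, whisker_assoc,
      Iso.inv_hom_id_assoc, ← whiskerLeft_comp_assoc, e₁]
    rw [associator_naturality_left_assoc, ← whisker_exchange_assoc,
      γ.naturality_naturality_assoc, whisker_exchange_assoc]
    simp)
  naturality_id c := (h _).injective (by
    have e₁ : (Λ.naturality (𝟙 c)).inv ≫ (P.mapId c).hom ▷ Λ.app c =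
        Λ.app c ◁ (Q.mapId c).hom ≫ (ρ_ _).hom ≫ (λ_ _).inv := by
      have := Λ.naturality_id c
      simp [Iso.inv_comp_eq, reassoc_of% this]
    simp only [comp_whiskerRight, liftNaturality_whiskerRight, Category.assoc, whisker_assoc,
      Iso.inv_hom_id_assoc, ← whiskerLeft_comp_assoc, e₁]
    have e₂ := whisker_exchange (e c).inv (Q.mapId c).hom
    have e₃ := whisker_exchange (W.mapId c).hom (e c).hom
    rw [comp_whiskerLeft, ← cancel_mono (α_ _ _ _).hom] at e₂
    simp only [Category.assoc, Iso.inv_hom_id, Category.comp_id] at e₂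
    rw [whiskerLeft_comp_assoc, ← reassoc_of% e₂, reassoc_of% (γ.naturality_id c),
      reassoc_of% e₃]
    simp)
  naturality_comp {c d i} f g := (h _).injective (by
    have e₁ : (Λ.naturality (f ≫ g)).inv ≫ (P.mapComp f g).hom ▷ Λ.app i =
        Λ.app c ◁ (Q.mapComp f g).hom ≫ (α_ _ _ _).inv ≫ (Λ.naturality f).inv ▷ Q.map g ≫
          (α_ _ _ _).hom ≫ P.map f ◁ (Λ.naturality g).inv ≫ (α_ _ _ _).inv := by
      have := Λ.naturality_comp f g
      simp [Iso.inv_comp_eq, reassoc_of% this]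
    have e₂ := whisker_exchange (e c).inv (Q.mapComp f g).hom
    have e₃ := whisker_exchange (W.mapComp f g).hom (e i).hom
    rw [comp_whiskerLeft, ← cancel_mono (α_ _ _ _).hom] at e₂
    simp only [Category.assoc, Iso.inv_hom_id, Category.comp_id] at e₂
    have e₄ := γ.naturality_comp f g
    simp only [comp_whiskerRight, liftNaturality_whiskerRight, Category.assoc, whisker_assoc,
      Iso.inv_hom_id_assoc, ← whiskerLeft_comp_assoc, e₁]
    rw [whiskerLeft_comp_assoc, ← reassoc_of% e₂, reassoc_of% e₄, reassoc_of% e₃]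
    simp [liftNaturality_whiskerRight, whiskerLeft_whiskerLeft_inv_exchange_assoc])

/-- The invertible modification exhibiting `liftTrans` as a factorization. -/
noncomputable def liftTransIso : liftTrans h γ k e ≫ Λ ≅ γ :=
  Pseudofunctor.StrongTrans.isoMk e (fun {c d} f => by
    change W.map f ◁ (e d).hom ≫ (γ.naturality f).hom =
      ((α_ _ _ _).inv ≫ (liftNaturality h γ k e f).hom ▷ Λ.app d ≫
          (α_ _ _ _).hom ≫ k c ◁ (Λ.naturality f).hom ≫ (α_ _ _ _).inv) ≫
          (e c).hom ▷ Q.map f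
    simp [liftNaturality_whiskerRight])

end Lift

theorem isIso_of_app {σ τ : P ⟶ Q} (m : σ ⟶ τ) (h : ∀ c, IsIso (m.as.app c)) : IsIso m :=
  (Pseudofunctor.StrongTrans.isoMk (fun c => asIso (m.as.app c))
    (fun f => m.as.naturality f) : σ ≅ τ).isIso_hom

theorem isIso_app {σ τ : P ⟶ Q} (m : σ ⟶ τ) [IsIso m] (c : C) : IsIso (m.as.app c) :=
  ⟨(inv m).as.app c, congrArg (fun n => n.as.app c) (IsIso.hom_inv_id m),
    congrArg (fun n => n.as.app c) (IsIso.inv_hom_id m)⟩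

/-! ### Pointwise inverters of a modification. -/

section Inverter

variable {R : C ⥤ᵖ B} {σ τ : Q ⟶ R} (μ : σ ⟶ τ)

/-- A pointwise inverter of a modification is an inverter in the bicategory of pseudofunctors. -/
theorem isInverter_of_app {Λ : P ⟶ Q} (h : ∀ c, IsInverter (μ.as.app c) (Λ.app c)) :
    IsInverter μ Λ := by
  refine isInverter_of_fullyFaithful (isIso_of_app _ fun c => (h c).isIso)
    (fullyFaithful_of_app fun c => (h c).fullyFaithful) fun {W} γ hγ => ?_
  choose k e using fun c => (h c).exists_lift (γ.app c) (isIso_app (γ ◁ μ) c)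
  exact ⟨liftTrans (fun c => (h c).fullyFaithful) γ k fun c => (e c).some, ⟨liftTransIso _ _ _ _⟩⟩

/-- Naturality of `μ` identifies `Q.map f ◁ μ_d` with `μ_c ▷ R.map f` up to the invertible
constraints of `σ` and `τ`. Hence cones over `μ_c` are carried to cones over `μ_d`, which is what
defines the inverter on 1-morphisms. -/
theorem isIso_whiskerLeft_map {c d : C} (f : c ⟶ d) {X : B} (p : X ⟶ Q.obj c)
    (h : IsIso (p ◁ μ.as.app c)) : IsIso ((p ≫ Q.map f) ◁ μ.as.app d) := by
  have e : Q.map f ◁ μ.as.app d =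
      (σ.naturality f).hom ≫ μ.as.app c ▷ R.map f ≫ (τ.naturality f).inv := by
    rw [← Category.assoc, Iso.eq_comp_inv]
    exact μ.as.naturality f
  have e' : p ◁ μ.as.app c ▷ R.map f =
      (α_ _ _ _).inv ≫ (p ◁ μ.as.app c) ▷ R.map f ≫ (α_ _ _ _).hom := by simp
  rw [comp_whiskerLeft, e, Bicategory.whiskerLeft_comp, Bicategory.whiskerLeft_comp, e']
  infer_instance

/-- Pointwise inverters of a modification combine into a pseudofunctor and a pseudonatural
transformation. -/
theorem exists_inverter (M₀ : C → B) (Λ₀ : ∀ c, M₀ c ⟶ Q.obj c)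
    (h : ∀ c, IsInverter (μ.as.app c) (Λ₀ c)) :
    ∃ (M : C ⥤ᵖ B) (Λ : M ⟶ Q),
      ∀ c, (⟨M.obj c, Λ.app c⟩ : (x : B) × (x ⟶ Q.obj c)) = ⟨M₀ c, Λ₀ c⟩ := by
  choose m s using fun {c d : C} (f : c ⟶ d) =>
    (h d).exists_lift (Λ₀ c ≫ Q.map f) (isIso_whiskerLeft_map μ f (Λ₀ c) (h c).isIso)
  let S : SubData Q := ⟨M₀, Λ₀, fun c => (h c).fullyFaithful, m, fun f => (s f).some⟩
  exact ⟨S.pseudofunctor, S.inclusion, fun c => rfl⟩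

end Inverter

end Pointwise
end BiTri

namespace BiTri

/-! ### Further compatibilities of whiskering needed for the triangles. -/

section MoreWhiskering

open Pseudofunctor.StrongTrans (isoMk)

variable {A : Type u₁} [Bicategory.{w₁, v₁} A] {B : Type u₂} [Bicategory.{w₂, v₂} B]
  {C : Type u₃} [Bicategory.{w₃, v₃} C] {D : Type u₄} [Bicategory.{w₄, v₄} D]

/-- Pre-whiskering of an invertible modification between transformations from `1`. -/
def preWhUnitIso (F : A ⥤ᵖ B) {T : B ⥤ᵖ B} {Φ Φ' : Pseudofunctor.id B ⟶ T} (e : Φ ≅ Φ') :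
    preWhUnit F Φ ≅ preWhUnit F Φ' :=
  isoMk (fun X => ⟨e.hom.as.app (F.obj X), e.inv.as.app (F.obj X),
      congrArg (fun m => m.as.app (F.obj X)) e.hom_inv_id,
      congrArg (fun m => m.as.app (F.obj X)) e.inv_hom_id⟩)
    (fun f => e.hom.as.naturality (F.map f))

/-- Post-whiskering of an invertible modification between transformations from `1`. -/
def postWhUnitIso {T : A ⥤ᵖ A} {Φ Φ' : Pseudofunctor.id A ⟶ T} (e : Φ ≅ Φ') (G : A ⥤ᵖ B) :
    postWhUnit Φ G ≅ postWhUnit Φ' G :=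
  isoMk (fun X => G.map₂Iso ⟨e.hom.as.app X, e.inv.as.app X,
      congrArg (fun m => m.as.app X) e.hom_inv_id,
      congrArg (fun m => m.as.app X) e.inv_hom_id⟩)
    (fun f => nat_mapMod G (e.hom.as.naturality f))

/-- Post-whiskering preserves composition, when the first transformation starts from `1`. -/
def postWhUnitComp {T T' : A ⥤ᵖ A} (Φ : Pseudofunctor.id A ⟶ T) (Ψ : T ⟶ T') (G : A ⥤ᵖ B) :
    postWhUnit (Φ ≫ Ψ) G ≅ postWhUnit Φ G ≫ postWh Ψ G :=
  isoMk (fun X => G.mapComp (Φ.app X) (Ψ.app X))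
    (fun f => nat_mapComp G (Φ.naturality f) (Ψ.naturality f))

/-- Pre-whiskering preserves composition through `1`. -/
def preWhThroughUnit (F : A ⥤ᵖ B) {S T : B ⥤ᵖ B} (κ : S ⟶ Pseudofunctor.id B)
    (Φ : Pseudofunctor.id B ⟶ T) :
    preWh F (κ ≫ Φ) ≅ preWhCounit F κ ≫ preWhUnit F Φ :=
  isoMk (fun _ => Iso.refl _) (fun f => nat_refl ((preWh F (κ ≫ Φ)).naturality f))

/-- Post-whiskering preserves composition through `1`. -/
def postWhThroughUnit {S T : A ⥤ᵖ A} (κ : S ⟶ Pseudofunctor.id A)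
    (Φ : Pseudofunctor.id A ⟶ T) (G : A ⥤ᵖ B) :
    postWh (κ ≫ Φ) G ≅ postWhCounit κ G ≫ postWhUnit Φ G :=
  isoMk (fun X => G.mapComp (κ.app X) (Φ.app X))
    (fun f => nat_mapComp G (κ.naturality f) (Φ.naturality f))

/-- Pseudonaturality of the associators in the middle pseudofunctor. -/
def assocMiddle (F : A ⥤ᵖ B) {G₁ G₂ : B ⥤ᵖ C} (Φ : G₁ ⟶ G₂) (H : C ⥤ᵖ D) :
    assoc F G₁ H ≫ postWh (preWh F Φ) H ≅ preWh F (postWh Φ H) ≫ assoc F G₂ H :=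
  (isoMk (η := preWh F (postWh Φ H) ≫ assoc F G₂ H) (θ := assoc F G₁ H ≫ postWh (preWh F Φ) H)
    (fun X => ρ_ (H.map (Φ.app (F.obj X))) ≪≫ (λ_ (H.map (Φ.app (F.obj X)))).symm)
    (fun f => nat_swap (mapSq H (Φ.naturality (F.map f))) _ rfl)).symm

/-- Pseudonaturality of the inverse associators in the outermost pseudofunctor. -/
def assocInvOuter (F : A ⥤ᵖ B) (G : B ⥤ᵖ C) {H₁ H₂ : C ⥤ᵖ D} (Ψ : H₁ ⟶ H₂) :
    assocInv F G H₁ ≫ preWh F (preWh G Ψ) ≅ preWh (F.comp G) Ψ ≫ assocInv F G H₂ :=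
  (isoMk (η := preWh (F.comp G) Ψ ≫ assocInv F G H₂) (θ := assocInv F G H₁ ≫ preWh F (preWh G Ψ))
    (fun X => ρ_ (Ψ.app (G.obj (F.obj X))) ≪≫ (λ_ (Ψ.app (G.obj (F.obj X)))).symm)
    (fun f => nat_swap (Ψ.naturality (G.map (F.map f))) _ rfl)).symm

end MoreWhiskering

/-! ### The two triangles after composition with fully faithful transformations. -/

section Triangle

variable {A : Type u₁} [Bicategory.{w₁, v₁} A] {B : Type u₂} [Bicategory.{w₂, v₂} B]
  {C : Type u₃} [Bicategory.{w₃, v₃} C] {T : B ⥤ᵖ B} {K M : C ⥤ᵖ B} {G : B ⥤ᵖ C}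
  (Φ : Pseudofunctor.id B ⟶ T) (Λ : M ⟶ K) (θ : G.comp K ⟶ T)
  (ψ : Pseudofunctor.id C ⟶ K.comp G) {η : Pseudofunctor.id C ⟶ M.comp G}
  {κ : G.comp M ⟶ Pseudofunctor.id B}

/-- The right triangle, after composition with `G(Φ)`. -/
def rightTriangleAux (i : η ≫ postWh Λ G ≅ ψ) (j : κ ≫ Φ ≅ preWh G Λ ≫ θ) :
    ((preWhUnit G η ≫ assoc G M G) ≫ postWhCounit κ G) ≫ postWhUnit Φ G ≅
      (preWhUnit G ψ ≫ assoc G K G) ≫ postWh θ G :=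
  α_ _ _ _ ≪≫ whiskerLeftIso (preWhUnit G η ≫ assoc G M G)
    ((postWhThroughUnit κ Φ G).symm ≪≫ postWhIso j G ≪≫ postWhComp (preWh G Λ) θ G) ≪⊗≫
  -- Moving `Λ` across the associator places it next to `η`, where `i` applies.
  whiskerLeftIso (preWhUnit G η) (whiskerRightIso (assocMiddle G Λ G) (postWh θ G)) ≪⊗≫
  whiskerRightIso ((preWhUnitComp G η (postWh Λ G)).symm ≪≫ preWhUnitIso G i)
    (assoc G K G ≫ postWh θ G) ≪⊗≫ Iso.refl _

/-- The left triangle, after composition with `Λ` and `Φ_K`. -/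
def leftTriangleAux (i : η ≫ postWh Λ G ≅ ψ) (j : κ ≫ Φ ≅ preWh G Λ ≫ θ) :
    (((postWhUnit η M ≫ assocInv M G M) ≫ preWhCounit M κ) ≫ Λ) ≫ preWhUnit K Φ ≅
      Λ ≫ (postWhUnit ψ K ≫ assocInv K G K) ≫ preWh K θ :=
  -- The exchange replaces `Φ_K ∘ Λ` by `T(Λ) ∘ Φ_M`, making `κ_M` and `Φ_M` adjacent so that `j`
  -- applies. There are then two copies of `Λ`, and they trade places: the one created by `j` moves
  -- to the front, while the original one becomes `K(G(Λ))` and is absorbed with `K(η)` by `i`.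
  α_ _ _ _ ≪≫ whiskerLeftIso ((postWhUnit η M ≫ assocInv M G M) ≫ preWhCounit M κ)
    (unitExchange Λ Φ).symm ≪⊗≫
  whiskerLeftIso (postWhUnit η M ≫ assocInv M G M)
    (whiskerRightIso ((preWhThroughUnit M κ Φ).symm ≪≫ preWhIso M j ≪≫
      preWhComp M (preWh G Λ) θ) (postWh Λ T)) ≪⊗≫
  whiskerLeftIso ((postWhUnit η M ≫ assocInv M G M) ≫ preWh M (preWh G Λ))
    (exchange Λ θ) ≪⊗≫
  whiskerLeftIso (postWhUnit η M) (whiskerRightIso (assocInvOuter M G Λ)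
    (postWh Λ (G.comp K) ≫ preWh K θ)) ≪⊗≫
  whiskerRightIso (postUnitExchange η Λ)
    (assocInv M G K ≫ postWh Λ (G.comp K) ≫ preWh K θ) ≪⊗≫
  whiskerLeftIso (Λ ≫ postWhUnit η K) (whiskerRightIso (assocInvInner Λ G K) (preWh K θ)) ≪⊗≫
  whiskerLeftIso Λ (whiskerRightIso ((postWhUnitComp η (postWh Λ G) K).symm ≪≫
    postWhUnitIso i K) (assocInv K G K ≫ preWh K θ)) ≪⊗≫ Iso.refl _

end Triangle

end BiTri

theorem mainTheorem2
    {A : Type u₁} [Bicategory.{w₁, v₁} A] {B : Type u₂} [Bicategory.{w₂, v₂} B]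
    {C : Type u₃} [Bicategory.{w₃, v₃} C]
    {F : A ⥤ᵖ B} {L : B ⥤ᵖ A} {G : B ⥤ᵖ C} {H : A ⥤ᵖ C} {N : C ⥤ᵖ A}
    (a : BiTri.Biadjunction L F) (b : BiTri.Biadjunction N H) (Γ : F.comp G ≌ H)
    (μ : BiTri.preWhUnit (N.comp F) a.unit ⟶ BiTri.xi a b Γ)
    (M₀ : C → B) (Λ₀ : ∀ c : C, M₀ c ⟶ (N.comp F).obj c)
    (hΛ : ∀ c : C, BiTri.IsInverter (μ.as.app c) (Λ₀ c))
    (hG : ∀ {X₀ X₁ X₂ : B} {f₁ f₂ : X₁ ⟶ X₂} (φ : f₁ ⟶ f₂) (f₀ : X₀ ⟶ X₁),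
      BiTri.IsInverter φ f₀ → BiTri.IsInverter (G.map₂ φ) (G.map f₀))
    (hμ : IsIso (BiTri.psi'' b Γ ◁ BiTri.postWhMod μ G))
    (ν : BiTri.preWhUnit (L.comp F) a.unit ⟶ BiTri.postWhUnit a.unit (L.comp F))
    (hμν : BiTri.preWhMod G μ ▷ BiTri.theta'' a b Γ ≫ (BiTri.phi₂ a b Γ).hom =
      (BiTri.phi₁ a b Γ).hom ≫ BiTri.theta' a b Γ ◁ ν)
    (hν : ∀ x : B, BiTri.IsInverter (ν.as.app x) (a.unit.app x)) :
    ∃ (M : C ⥤ᵖ B) (Λ : M ⟶ N.comp F),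
      (∀ c : C, (⟨M.obj c, Λ.app c⟩ : (x : B) × (x ⟶ (N.comp F).obj c)) = ⟨M₀ c, Λ₀ c⟩) ∧
      BiTri.IsInverter μ Λ ∧
      Nonempty (BiTri.Biadjunction M G) := by
  obtain ⟨M, Λ, hM⟩ := BiTri.exists_inverter μ M₀ Λ₀ hΛ
  have hΛ' : ∀ c, BiTri.IsInverter (μ.as.app c) (Λ.app c) := fun c => by
    have key : ∀ p q : (x : B) × (x ⟶ (N.comp F).obj c), p = q →
        BiTri.IsInverter (μ.as.app c) q.2 → BiTri.IsInverter (μ.as.app c) p.2 := by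
      rintro p _ rfl h; exact h
    exact key _ _ (hM c) (hΛ c)
  have hμΛ : BiTri.IsInverter μ Λ := BiTri.isInverter_of_app μ hΛ'
  refine ⟨M, Λ, hM, hμΛ, ?_⟩
  have hGΛ : BiTri.IsInverter (BiTri.postWhMod μ G) (BiTri.postWh Λ G) :=
    BiTri.isInverter_of_app _ fun c => hG _ _ (hΛ' c)
  -- The unit of the new biadjunction.
  obtain ⟨η, ⟨i⟩⟩ := hGΛ.exists_lift (BiTri.psi'' b Γ) hμ
  have hΦ : BiTri.IsInverter ν a.unit := BiTri.isInverter_of_app ν hν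
  have hcone : IsIso ((BiTri.preWh G Λ ≫ BiTri.theta' a b Γ) ◁ ν) := by
    have h₁ : IsIso (BiTri.preWh G Λ ◁ BiTri.preWhMod G μ) :=
      BiTri.isIso_of_app _ fun x => (hΛ' (G.obj x)).isIso
    -- The compatibility of `μ` and `ν` exhibits `ν * Θ'` as `Θ'' * μ_G` between invertible
    -- modifications, and `Λ_G` inverts `μ_G`.
    have h₂ : BiTri.theta' a b Γ ◁ ν = (BiTri.phi₁ a b Γ).inv ≫
        BiTri.preWhMod G μ ▷ BiTri.theta'' a b Γ ≫ (BiTri.phi₂ a b Γ).hom :=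
      (Iso.eq_inv_comp _).2 hμν.symm
    have h₃ : BiTri.preWh G Λ ◁ BiTri.preWhMod G μ ▷ BiTri.theta'' a b Γ =
        (α_ _ _ _).inv ≫ (BiTri.preWh G Λ ◁ BiTri.preWhMod G μ) ▷ BiTri.theta'' a b Γ ≫
          (α_ _ _ _).hom := by simp
    rw [comp_whiskerLeft, h₂, Bicategory.whiskerLeft_comp, Bicategory.whiskerLeft_comp, h₃]
    infer_instance
  -- The counit of the new biadjunction.
  obtain ⟨κ, ⟨j⟩⟩ := hΦ.exists_lift (BiTri.preWh G Λ ≫ BiTri.theta' a b Γ) hcone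
  have hGΦ : BiTri.FullyFaithful (BiTri.postWhUnit a.unit G) :=
    BiTri.fullyFaithful_of_app fun x => (hG _ _ (hν x)).fullyFaithful
  have hΦK : BiTri.FullyFaithful (BiTri.preWhUnit (N.comp F) a.unit) :=
    BiTri.fullyFaithful_of_app fun c => (hν _).fullyFaithful
  have e₁ : Λ ≫ BiTri.xi a b Γ ≅ Λ ≫ BiTri.preWhUnit (N.comp F) a.unit :=
    haveI := hμΛ.isIso
    (asIso (Λ ◁ μ)).symm
  exact ⟨{
    unit := η
    counit := κ
    -- Two liftings: the inner one cancels `Φ_{FN}`, the outer one cancels `Λ`. The target of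
    -- `leftTriangleAux` is `Λ ≫ xi a b Γ` by definition.
    leftTriangle := hμΛ.fullyFaithful.liftIso (hΦK.liftIso
      (BiTri.leftTriangleAux a.unit Λ (BiTri.theta' a b Γ) (BiTri.psi'' b Γ) i j ≪≫ e₁ ≪≫
        whiskerRightIso (λ_ Λ).symm _))
    rightTriangle := hGΦ.liftIso
      (BiTri.rightTriangleAux a.unit Λ (BiTri.theta' a b Γ) (BiTri.psi'' b Γ) i j ≪≫
        BiTri.phi₂'' a b Γ ≪≫ (λ_ _).symm) }⟩
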